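/- For a real number $x$ let $\|x\|$ be the distance from $x$ to the nearest integer and $\lceil x\rceil$ the smallest integer not less than $x$. Let $P(X)=a_dX^d+\cdots+a_0\in\mathbb Z[X]$ be an irreducible polynomial with $d\ge 1$, $a_d\ge 1$, $\gcd(a_d,\ldots,a_0)=1$, $a_0\neq 0$, without multiple roots, each of whose irreducible factors in $\mathbb Z[X]$ has at least one root of modulus greater than $1$. Let $\alpha_1,\ldots,\alpha_d$ be its complex roots, ordered so that $|\alpha_i|>1$ for $1\le i\le p$ and $|\alpha_i|\le 1$ for $p+1\le i\le d$. For an integer $k\ge 0$ let $\Xi_k$ be the set of tuples $\boldsymbol g=(g_1,\ldots,g_p)$ of polynomials in $\mathbb C[X]$ with $\deg g_i\le k$ such that $g_j=\overline{g_i}$ (coefficientwise conjugation) whenever $\alpha_j=\overline{\alpha_i}$, $1\le i,j\le p$ (in particular $g_i\in\mathbb R[X]$ if $\alpha_i\in\mathbb R$). Put $$x_n(\boldsymbol g)=\sum_{i=1}^p g_i(n)\alpha_i^n\in\mathbb R,\qquad \mathcal L^{(k)}(P)=\Bigl\{\limsup_{n\to\infty}\|x_n(\boldsymbol g)\| \;:\;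 \boldsymbol g\in\Xi_k\Bigr\}.$$ Suppose that $P$ is monic and hyperbolic, i.e. $|\alpha_i|\ne 1$ for all $i$. Let $$\beta_1=\min_{1\le i\le p}|\alpha_i|,\qquad \beta_2=\min_{p+1\le i\le d}|\alpha_i|^{-1},\qquad \beta=\min\{\beta_1,\beta_2\},$$ where $\beta_2=+\infty$ if $p=d$, and for $n\in\mathbb Z$ let $$\rho_n=\frac{-1}{2\pi i}\int_{|z|=R}\frac{z^{n-1}}{P(z)}\,dz ,$$ the circle being positively oriented and $R>1$ so close to $1$ that $P$ has no root with $1<|z|\le R$. (1) For every integer $k\ge0$, $1/2$ is an accumulation point of $\mathcal L^{(k)}(P)$. (2) Assume that either $\beta=|\alpha_i|$ for exactly one index $i\in\{1,\dots,p\}$, or $\beta=|\alpha_i|^{-1}$ for exactly one index $i\in\{p+1,\dots,d\}$, and that $$\Bigl\lceil\frac{\beta-1}{2}\Bigr\rceil\sum_{n\in\mathbb Z}|\rho_n|<\frac12 .$$ Then there are intervals $[c_i,d_i]\subset\mathcal L^{(0)}(P)$ with $c_i<d_i$ $(i=1,2,\ldots)$ and $\lim_{i\to\infty}c_i=1/2$.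 (3) Assume that $\beta_1=|\alpha_i|$ for exactly one index $i\in\{1,\dots,p\}$, that $\beta_2=|\alpha_i|^{-1}$ for exactly one index $i\in\{p+1,\dots,d\}$ (in particular $p<d$), and that $$\Bigl\lceil\frac{\widetilde\beta-1}{2}\Bigr\rceil\sum_{n\in\mathbb Z}|\rho_n|<\frac12,\qquad \widetilde\beta=\max\{\beta_1,\beta_2\}.$$ Then there is a $v<1/2$ with $[v,1/2]\subset\mathcal L^{(0)}(P)$. -/

import Mathlib

open Polynomial Filter Topology

noncomputable section

namespace MarkoffLagrange

/-- The set of complex roots of an integer polynomial `P`. -/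
def complexRoots (P : ℤ[X]) : Finset ℂ := (P.aroots ℂ).toFinset

/-- The expanding roots of `P`: those of modulus greater than `1`. -/
def expandingRoots (P : ℤ[X]) : Finset ℂ := (complexRoots P).filter fun α => 1 < ‖α‖

/-- The non-expanding roots of `P`: those of modulus at most `1`. -/
def nonexpandingRoots (P : ℤ[X]) : Finset ℂ := (complexRoots P).filter fun α => ‖α‖ ≤ 1

/-- The standing assumptions on the integer polynomial `P`. -/
structure Admissible (P : ℤ[X]) : Prop where
  irreducible : Irreducible P
  one_le_natDegree : 1 ≤ P.natDegree
  one_le_leadingCoeff : 1 ≤ P.leadingCoeff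
  isPrimitive : P.IsPrimitive
  coeff_zero_ne : P.coeff 0 ≠ 0
  nodup_roots : (P.aroots ℂ).Nodup
  exists_expanding : ∀ Q : ℤ[X], Irreducible Q → Q ∣ P → ∃ α ∈ complexRoots Q, 1 < ‖α‖

/-- `P` is hyperbolic if it has no complex root of modulus `1`. -/
def Hyperbolic (P : ℤ[X]) : Prop := ∀ α ∈ complexRoots P, ‖α‖ ≠ 1

/-- The families `g = (g_α)` of complex polynomials of degree at most `k`, indexed by the expanding
roots `α` of `P`, such that the polynomial attached to the conjugate of `α` is the
(coefficientwise) conjugate of `g_α`. For a real root `α` this says that `g_α` has real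
coefficients. (Values of `g` at other points of `ℂ` play no role.) -/
def Xi (k : ℕ) (P : ℤ[X]) : Set (ℂ → ℂ[X]) :=
  {g | ∀ α ∈ expandingRoots P, (g α).natDegree ≤ k ∧
    g (starRingEnd ℂ α) = (g α).map (starRingEnd ℂ)}

/-- The linear recurrence `x_n(g) = ∑ g_α(n) α ^ n`, the sum being over the expanding roots of `P`.
The sum is a real number when `g ∈ Xi k P`. -/
def recSeq (P : ℤ[X]) (g : ℂ → ℂ[X]) (n : ℤ) : ℝ :=
  (∑ α ∈ expandingRoots P, (g α).eval (n : ℂ) * α ^ n).re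

/-- The distance from a real number to the nearest integer. -/
def distInt (x : ℝ) : ℝ := |x - round x|

/-- The multiplicative Markoff-Lagrange spectrum `L^{(k)}(P)`. -/
def spectrum (k : ℕ) (P : ℤ[X]) : Set ℝ :=
  {y | ∃ g ∈ Xi k P, y = limsup (fun n : ℕ => distInt (recSeq P g (n : ℤ))) atTop}

/-- `ρ_n = -1/(2πi) ∫_{|z| = 1 + 0} z ^ (n - 1) / f(z) dz`: the integral is over the positively
oriented circle `|z| = R` in the limit `R ↓ 1` (it does not depend on `R > 1` close to `1`). -/
def rho (f : ℤ[X]) (n : ℤ) : ℂ :=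
  -1 / (2 * (Real.pi : ℂ) * Complex.I) *
    limUnder (𝓝[>] (1 : ℝ)) fun R : ℝ => ∮ z in C(0, R), z ^ (n - 1) / aeval z f

/-- The moduli `|α|` of the expanding roots. -/
def expandingModuli (P : ℤ[X]) : Set ℝ := {r | ∃ α ∈ expandingRoots P, r = ‖α‖}

/-- The inverse moduli `|α|⁻¹` of the non-expanding roots. -/
def nonexpandingInvModuli (P : ℤ[X]) : Set ℝ := {r | ∃ α ∈ nonexpandingRoots P, r = ‖α‖⁻¹}

/-- `β₁`, the least modulus of an expanding root. -/
def beta₁ (P : ℤ[X]) : ℝ := sInf (expandingModuli P)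

/-- `β₂`, the least inverse modulus of a non-expanding root (only meaningful when there are
non-expanding roots). -/
def beta₂ (P : ℤ[X]) : ℝ := sInf (nonexpandingInvModuli P)

/-- `β = min {β₁, β₂}`, where `β₂ = +∞` (so that `β = β₁`) when there is no non-expanding root;
that is, the least element of the union of the two finite sets over which `β₁` and `β₂` are
minima. -/
def beta (P : ℤ[X]) : ℝ := sInf (expandingModuli P ∪ nonexpandingInvModuli P)

end MarkoffLagrange

end

namespace MarkoffLagrange

/-! By residues, `rho P n` is a sum over the expanding roots minus, for `n > 0`, an integer
(`Admissible.rho_eq`). Hence for a bounded integer sequence `t` the number `∑ ρ_(n-j) t_j` agrees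
modulo 1 with some `x_n(g)`, `g` constant, and its limsup lies in the spectrum
(`Admissible.limsup_mem_spectrum`). Hyperbolicity makes `ρ` decay geometrically on both sides.

Parts (2) and (3) both come from an interval `[v, 1/2]`. Put `M = ⌈(β - 1) / 2⌉`. A unique root of
extremal modulus is real and governs `ρ` asymptotically on one side, with ratio `|a| < 2M + 1`, so
by Kakeya's criterion tails with digits in `[-M, M]` fill intervals. One larger digit followed by a
suitable tail makes the value exactly `1/2` at some place. Since `M ∑ |ρ_n| < 1/2`, only finitely
many places come close to `1/2`, and changing a far tail lowers the maximum by any prescribed small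
amount (`DigitKernel.exists_interval`). Concatenating longer and longer windows of the two-sided
sequence turns its maximum into a limsup (`exists_limsup_distInt_eq`).

Part (1) needs no digits: for an odd prime `q` not dividing `P(0)`, a rational multiple of the
integer impulse response of `P` gives the limsup `1/2 - 1/(2q)`
(`Admissible.half_sub_mem_spectrum`). -/

/-! ### Distance to the nearest integer. -/

lemma distInt_eq_norm (x : ℝ) : distInt x = ‖(x : UnitAddCircle)‖ :=
  (UnitAddCircle.norm_eq).symm

lemma distInt_nonneg (x : ℝ) : 0 ≤ distInt x := abs_nonneg _

lemma distInt_le_half (x : ℝ) : distInt x ≤ 1 / 2 := abs_sub_round x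

lemma distInt_le_abs (x : ℝ) : distInt x ≤ |x| := by
  simpa [distInt] using round_le x 0

lemma distInt_add_intCast (x : ℝ) (k : ℤ) : distInt (x + k) = distInt x := by
  simp [distInt]

lemma abs_distInt_sub_le (x y : ℝ) : |distInt x - distInt y| ≤ |x - y| := by
  rw [distInt_eq_norm, distInt_eq_norm]
  refine (abs_norm_sub_norm_le _ _).trans ?_
  have := distInt_le_abs (x - y)
  rwa [distInt_eq_norm, AddCircle.coe_sub] at this

lemma distInt_le_add (x y : ℝ) : distInt x ≤ distInt y + |x - y| := by
  have := (abs_le.1 (abs_distInt_sub_le x y)).2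
  linarith

lemma distInt_eq_abs {x : ℝ} (hx : |x| ≤ 1 / 2) : distInt x = |x| := by
  rw [distInt_eq_norm, AddCircle.norm_coe_eq_abs_iff _ one_ne_zero]
  simpa using hx

lemma distInt_add_of_half {x δ : ℝ} (hx : distInt x = 1 / 2) (hδ : |δ| ≤ 1 / 2) :
    distInt (x + δ) = 1 / 2 - |δ| := by
  obtain ⟨k, hk⟩ : ∃ k : ℤ, x = 1 / 2 + k := by
    rcases (abs_eq (by norm_num)).1 hx with h | h
    · exact ⟨round x, by linarith⟩
    · exact ⟨round x - 1, by push_cast; linarith⟩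
  have hδ' := abs_le.1 hδ
  rcases le_total δ 0 with h | h
  · rw [hk, show (1 / 2 + (k : ℝ) + δ) = (1 / 2 + δ) + k by ring, distInt_add_intCast,
      distInt_eq_abs, abs_of_nonpos h, abs_of_nonneg] <;> try linarith
    rw [abs_le]; constructor <;> linarith
  · rw [hk, show (1 / 2 + (k : ℝ) + δ) = (-1 / 2 + δ) + (k + 1 : ℤ) by push_cast; ring,
      distInt_add_intCast, distInt_eq_abs, abs_of_nonneg h, abs_of_nonpos] <;> try linarith
    rw [abs_le]; constructor <;> linarith

lemma limsup_distInt_eq {f : ℕ → ℝ} {y : ℝ}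
    (h₁ : ∀ δ > 0, ∀ᶠ n in atTop, distInt (f n) ≤ y + δ)
    (h₂ : ∀ δ > 0, ∃ᶠ n in atTop, y - δ ≤ distInt (f n)) :
    limsup (fun n => distInt (f n)) atTop = y := by
  have hb : IsBoundedUnder (· ≤ ·) atTop (fun n => distInt (f n)) :=
    isBoundedUnder_of ⟨1 / 2, fun n => distInt_le_half _⟩
  have hc : IsCoboundedUnder (· ≤ ·) atTop (fun n => distInt (f n)) :=
    (isBoundedUnder_of ⟨0, fun n => distInt_nonneg _⟩ :
      IsBoundedUnder (· ≥ ·) atTop (fun n => distInt (f n))).isCoboundedUnder_le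
  apply le_antisymm
  · exact le_of_forall_pos_le_add fun δ hδ => limsup_le_of_le hc (h₁ δ hδ)
  · refine le_of_forall_pos_le_add fun δ hδ => ?_
    have := le_limsup_of_frequently_le (h₂ δ hδ) hb
    linarith

/-! ### Greedy expansions and Kakeya's criterion. -/

/-- One step of the greedy expansion. -/
lemma exists_digit {M : ℤ} (hM : 0 ≤ M) {u R y : ℝ} (hu : |u| ≤ 2 * R)
    (hy : |y| ≤ M * |u| + R) : ∃ t : ℤ, |t| ≤ M ∧ |y - u * t| ≤ R := by
  have hR : 0 ≤ R := by linarith [abs_nonneg u]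
  by_cases hu0 : u = 0
  · exact ⟨0, by simpa using hM, by simpa [hu0] using hy⟩
  have hupos : 0 < |u| := abs_pos.2 hu0
  have hM' : (0 : ℝ) ≤ M := by exact_mod_cast hM
  have key : y = u * (y / u) := by field_simp
  set w := y / u with hw
  have hyw : |y| = |u| * |w| := by rw [key, abs_mul]
  have hmono : ∀ x y : ℝ, x ≤ y → round x ≤ round y := fun x y h => by
    rw [round_eq, round_eq]; exact Int.floor_mono (by linarith)
  -- If `|w| ≤ M`, the nearest integer leaves an error of at most `|u| / 2 ≤ R`; otherwise the
  -- extreme digit of the right sign leaves `|y| - M |u| ≤ R`.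
  by_cases h : |w| ≤ M
  · refine ⟨round w, ?_, ?_⟩
    · have h1 := abs_le.1 h
      rw [abs_le]
      constructor
      · have : round ((-M : ℤ) : ℝ) ≤ round w :=
          hmono _ _ (by push_cast; exact h1.1)
        rwa [round_intCast] at this
      · have : round w ≤ round (M : ℝ) := hmono _ _ h1.2
        rwa [round_intCast] at this
    · rw [key, ← mul_sub, abs_mul]
      have := abs_sub_round w
      nlinarith
  · push Not at h
    rcases le_total 0 w with h0 | h0
    · refine ⟨M, by rw [abs_of_nonneg hM], ?_⟩
      rw [key, ← mul_sub, abs_mul]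
      rw [abs_of_nonneg h0] at h hyw
      rw [abs_of_nonneg (a := w - M) (by linarith)]
      nlinarith
    · refine ⟨-M, by rw [abs_neg, abs_of_nonneg hM], ?_⟩
      rw [key, ← mul_sub, abs_mul]
      rw [abs_of_nonpos h0] at h hyw
      push_cast
      rw [abs_of_nonpos (a := w - -M) (by linarith)]
      nlinarith

/-- Kakeya's criterion: if no term of a series exceeds the sum of the following ones, weighted by
the number of digits, then the sums with digits in `[-M, M]` fill an interval. -/
lemma exists_hasSum_digits {M : ℤ} (hM : 0 ≤ M) {u : ℕ → ℝ} (hu : Summable fun i => |u i|)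
    (hK : ∀ i, |u i| ≤ 2 * (M * ∑' k, |u (i + 1 + k)|)) {y : ℝ}
    (hy : |y| ≤ M * ∑' i, |u i|) :
    ∃ t : ℕ → ℤ, (∀ i, |t i| ≤ M) ∧ HasSum (fun i => u i * t i) y := by
  -- `R i` bounds every sum formed with the terms from `i` on. The greedy remainder stays within `R
  -- i`, hence tends to 0.
  set R : ℕ → ℝ := fun i => M * ∑' k, |u (i + k)| with hR
  have hsh : ∀ i, Summable fun k => |u (i + k)| := fun i => by
    simpa [add_comm] using (summable_nat_add_iff i).2 hu
  have hRs : ∀ i, R i = M * |u i| + R (i + 1) := fun i => by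
    simp only [hR]
    rw [(hsh i).tsum_eq_zero_add, mul_add]
    simp [add_assoc, add_comm 1]
  have hstep : ∀ (i : ℕ) (y : ℝ), ∃ t : ℤ, |y| ≤ R i → |t| ≤ M ∧ |y - u i * t| ≤ R (i + 1) := by
    intro i y
    by_cases h : |y| ≤ R i
    · obtain ⟨t, ht⟩ := exists_digit hM (hK i) (y := y) (by rw [hRs] at h; exact h)
      exact ⟨t, fun _ => ht⟩
    · exact ⟨0, fun h' => absurd h' h⟩
  choose d hd using hstep
  let z : ℕ → ℝ := fun n => Nat.rec y (fun i w => w - u i * d i w) n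
  have hz0 : z 0 = y := rfl
  have hzs : ∀ i, z (i + 1) = z i - u i * d i (z i) := fun i => rfl
  have hz : ∀ i, |z i| ≤ R i := by
    intro i
    induction i with
    | zero => simpa [hz0, hR] using hy
    | succ i ih => rw [hzs]; exact (hd i _ ih).2
  have hR0 : Tendsto R atTop (𝓝 0) := by
    have := (tendsto_sum_nat_add fun i => |u i|).const_mul (M : ℝ)
    simpa [hR, add_comm] using this
  have hz0' : Tendsto z atTop (𝓝 0) := squeeze_zero_norm hz hR0
  refine ⟨fun i => d i (z i), fun i => (hd i _ (hz i)).1, ?_⟩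
  have hsum : Summable fun i => u i * (d i (z i) : ℝ) := by
    refine Summable.of_norm_bounded (hu.mul_left (M : ℝ)) fun i => ?_
    rw [Real.norm_eq_abs, abs_mul, mul_comm]
    gcongr
    exact_mod_cast (hd i _ (hz i)).1
  rw [hsum.hasSum_iff_tendsto_nat]
  have hpart : ∀ n, ∑ i ∈ Finset.range n, u i * (d i (z i) : ℝ) = y - z n := by
    intro n
    induction n with
    | zero => simp [hz0]
    | succ n ih => rw [Finset.sum_range_succ, ih, hzs]; ring
  simp_rw [hpart]
  simpa using hz0'.const_sub y

/-- A sequence which is asymptotically geometric with ratio of modulus less than `2 M + 1`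
eventually satisfies Kakeya's criterion. -/
lemma eventually_le_tail {M : ℤ} {f : ℕ → ℝ} (hf : Summable fun i => |f i|) {a C : ℝ}
    (ha : 1 < |a|) (haM : |a| < 2 * M + 1) (hC : C ≠ 0)
    (hlim : Tendsto (fun j => f j * a ^ j) atTop (𝓝 C)) :
    ∀ᶠ j in atTop, f j ≠ 0 ∧ |f j| ≤ 2 * (M * ∑' k, |f (j + 1 + k)|) := by
  have hM : (0 : ℝ) < M := by linarith
  have ha0 : 0 < |a| := by linarith
  have habs : Tendsto (fun j => |f j| * |a| ^ j) atTop (𝓝 |C|) := by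
    simpa [abs_mul, abs_pow] using hlim.abs
  -- The full geometric series sums to `1 / (|a| - 1)`, and `2M / (|a| - 1) > 1`. Truncating at `K`
  -- keeps the strict inequality and leaves finitely many terms, so the asymptotics of `f` can be
  -- inserted term by term.
  obtain ⟨K, hK⟩ : ∃ K : ℕ, 1 < 2 * (M * ∑ i ∈ Finset.range K, (|a|⁻¹) ^ (i + 1)) := by
    have hg : HasSum (fun i => (|a|⁻¹) ^ (i + 1)) ((1 - |a|⁻¹)⁻¹ * |a|⁻¹) := by
      simpa [pow_succ] using (hasSum_geometric_of_lt_one (inv_nonneg.2 ha0.le)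
        (inv_lt_one_of_one_lt₀ ha)).mul_right |a|⁻¹
    have h1 : 1 < 2 * (M * ((1 - |a|⁻¹)⁻¹ * |a|⁻¹)) := by
      have : (1 - |a|⁻¹)⁻¹ * |a|⁻¹ = (|a| - 1)⁻¹ := by
        have : |a| - 1 ≠ 0 := by linarith
        rw [← mul_inv]
        congr 1
        field_simp
      rw [this, ← mul_assoc, ← div_eq_mul_inv, one_lt_div (by linarith)]
      linarith
    have h2 := ((hg.tendsto_sum_nat.const_mul (M : ℝ)).const_mul 2).eventually (lt_mem_nhds h1)
    exact h2.exists
  have hlim2 : Tendsto (fun j => 2 * (M * ∑ i ∈ Finset.range K, |f (j + 1 + i)|) * |a| ^ j) atTop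
      (𝓝 (|C| * (2 * (M * ∑ i ∈ Finset.range K, (|a|⁻¹) ^ (i + 1))))) := by
    have h1 : ∀ i, Tendsto (fun j => |f (j + 1 + i)| * |a| ^ j) atTop
        (𝓝 (|C| * (|a|⁻¹) ^ (i + 1))) := by
      intro i
      have := (habs.comp (tendsto_add_atTop_nat (i + 1))).mul_const ((|a|⁻¹) ^ (i + 1))
      refine this.congr fun j => ?_
      simp only [Function.comp]
      rw [pow_add, mul_assoc, mul_assoc, ← mul_pow, mul_inv_cancel₀ ha0.ne', one_pow, mul_one,
        show j + (i + 1) = j + 1 + i by ring]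
    have h2 := ((tendsto_finsetSum (Finset.range K) fun i _ => h1 i).const_mul (M : ℝ)).const_mul 2
    convert h2 using 2
    · rw [← Finset.sum_mul]; ring
    · rw [← Finset.mul_sum]; ring
  have hlt : |C| < |C| * (2 * (M * ∑ i ∈ Finset.range K, (|a|⁻¹) ^ (i + 1))) := by
    have := abs_pos.2 hC
    nlinarith
  filter_upwards [habs.eventually_lt hlim2 hlt, habs.eventually (lt_mem_nhds (abs_pos.2 hC))]
    with j h1 h2
  refine ⟨fun h0 => by simp [h0] at h2, ?_⟩
  have h3 := (lt_of_mul_lt_mul_right h1 (by positivity)).le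
  refine h3.trans ?_
  gcongr
  have : Summable fun k => |f (j + 1 + k)| := by
    simpa [add_comm] using (summable_nat_add_iff (j + 1)).2 hf
  exact this.sum_le_tsum _ fun _ _ => abs_nonneg _

/-- The quotient `f j / f (j + e)` tends to `a ^ e`. The error is kept relative to `f (j + e)` so
that it can later be summed over a tail. -/
lemma eventually_ratio {f : ℕ → ℝ} {a C : ℝ} (ha : a ≠ 0) (hC : C ≠ 0)
    (hlim : Tendsto (fun j => f j * a ^ j) atTop (𝓝 C)) (e : ℕ) {ω : ℝ} (hω : 0 < ω) :
    ∀ᶠ j in atTop, |f j - a ^ e * f (j + e)| ≤ ω * |f (j + e)| := by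
  have h2 := hlim.comp (tendsto_add_atTop_nat e)
  have h3 : Tendsto (fun j => a ^ e * (f j * a ^ j) / (f (j + e) * a ^ (j + e))) atTop
      (𝓝 (a ^ e * C / C)) := (hlim.const_mul _).div h2 hC
  rw [mul_div_cancel_right₀ _ hC] at h3
  filter_upwards [h3.eventually (Metric.ball_mem_nhds _ hω), h2.eventually_ne hC] with j h4 h5
  have h6 : f (j + e) ≠ 0 := by
    intro h; simp [Function.comp, h] at h5
  have h7 : f j - a ^ e * f (j + e) =
      (a ^ e * (f j * a ^ j) / (f (j + e) * a ^ (j + e)) - a ^ e) * f (j + e) := by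
    rw [pow_add]
    field_simp
  rw [h7, abs_mul]
  gcongr
  exact (Real.dist_eq _ _ ▸ h4.le : _)

/-! ### Convolutions with digit sequences, and lowering the maximal value. -/

/-- The convolution of a two-sided real sequence with a two-sided integer sequence. -/
noncomputable def convInt (r : ℤ → ℝ) (s : ℤ → ℤ) (n : ℤ) : ℝ := ∑' j : ℤ, r (n - j) * s j

lemma summable_abs_sub {r : ℤ → ℝ} (hr : Summable fun j => |r j|) (n : ℤ) :
    Summable fun j => |r (n - j)| :=
  (Equiv.subLeft n).summable_iff.2 hr

lemma tsum_abs_sub (r : ℤ → ℝ) (n : ℤ) : ∑' j, |r (n - j)| = ∑' j, |r j| :=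
  (Equiv.subLeft n).tsum_eq fun j => |r j|

lemma summable_abs_shift {r : ℤ → ℝ} (hr : Summable fun j => |r j|) (n N : ℤ) :
    Summable fun i : ℕ => |r (n - (N + i))| :=
  (summable_abs_sub hr n).comp_injective
    (i := fun i : ℕ => N + (i : ℤ)) fun i j h => by simpa using h

lemma summable_convInt {r : ℤ → ℝ} (hr : Summable fun j => |r j|) {s : ℤ → ℤ} {B : ℝ}
    (hs : ∀ j, |(s j : ℝ)| ≤ B) (n : ℤ) : Summable fun j => r (n - j) * (s j : ℝ) := by
  refine Summable.of_norm_bounded ((summable_abs_sub hr n).mul_right B) fun j => ?_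
  rw [Real.norm_eq_abs, abs_mul]
  gcongr
  exact hs j

lemma convInt_eq_tsum (r : ℤ → ℝ) (s : ℤ → ℤ) (n : ℤ) :
    convInt r s n = ∑' j, r j * (s (n - j) : ℝ) := by
  rw [convInt, ← (Equiv.subLeft n).tsum_eq]
  simp

lemma convInt_reflect (r : ℤ → ℝ) (s : ℤ → ℤ) (n : ℤ) :
    convInt r (fun j => s (-j)) n = convInt (fun j => r (-j)) s (-n) := by
  rw [convInt, convInt, ← (Equiv.neg ℤ).tsum_eq]
  simp [sub_eq_add_neg, add_comm]

lemma abs_tsum_le_of_summable {ι : Type*} {f g : ι → ℝ} (hg : Summable g) (h : ∀ i, |f i| ≤ g i) :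
    |∑' i, f i| ≤ ∑' i, g i := by
  have hf : Summable fun i => ‖f i‖ := Summable.of_nonneg_of_le (fun _ => abs_nonneg _) h hg
  exact (norm_tsum_le_tsum_norm hf).trans (hf.tsum_le_tsum h hg)

/-- The values of `s` from index `N` on are replaced by those of `t`. -/
def replaceTail (s : ℤ → ℤ) (N : ℤ) (t : ℕ → ℤ) (j : ℤ) : ℤ :=
  if j < N then s j else t (j - N).toNat

lemma convInt_replaceTail {r : ℤ → ℝ} (hr : Summable fun j => |r j|) {s : ℤ → ℤ} {t : ℕ → ℤ}
    {B : ℝ} (hs : ∀ j, |(s j : ℝ)| ≤ B) (ht : ∀ j, |(t j : ℝ)| ≤ B) (N n : ℤ) :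
    convInt r (replaceTail s N t) n =
      convInt r s n + ∑' i : ℕ, r (n - (N + i)) * ((t i : ℝ) - s (N + i)) := by
  have hs' : ∀ j, |((replaceTail s N t j : ℤ) : ℝ)| ≤ B := fun j => by
    unfold replaceTail; split_ifs; exacts [hs _, ht _]
  have hinj : Function.Injective fun i : ℕ => N + (i : ℤ) := fun i j h => by simpa using h
  have h1 : ∑' i : ℕ, r (n - (N + i)) * ((t i : ℝ) - s (N + i)) =
      ∑' j : ℤ, r (n - j) * ((replaceTail s N t j : ℝ) - s j) := by
    rw [← hinj.tsum_eq (f := fun j : ℤ => r (n - j) * ((replaceTail s N t j : ℝ) - s j))]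
    · simp [replaceTail, show ∀ i : ℕ, ¬ (i : ℤ) < 0 from fun i => by omega]
    · intro j hj
      by_contra h
      have : j < N := by
        by_contra h'
        exact h ⟨(j - N).toNat, by simp only []; omega⟩
      simp [replaceTail, this] at hj
  rw [h1, convInt, convInt, ← (summable_convInt hr hs n).tsum_add]
  · exact tsum_congr fun j => by ring
  · simp_rw [mul_sub]
    exact (summable_convInt hr hs' n).sub (summable_convInt hr hs n)

lemma tendsto_tail (r : ℤ → ℝ) (M n : ℤ) :
    Tendsto (fun N : ℕ => M * ∑' i : ℕ, |r (n - ((N : ℤ) + i))|) atTop (𝓝 0) := by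
  have := (tendsto_sum_nat_add fun i : ℕ => |r (n - i)|).const_mul (M : ℝ)
  simpa [add_comm] using this

/-- A real two-sided sequence `r` for which the series `∑ r (n - j) s_j` with digits in `[-M, M]`
are less than `1 / 2`, while the sums of the tails of the series fill intervals. -/
structure DigitKernel (r : ℤ → ℝ) (M : ℤ) (a C : ℝ) : Prop where
  summable : Summable fun j => |r j|
  one_lt : 1 < |a|
  lt_digits : |a| < 2 * M + 1
  ne_zero : C ≠ 0
  lim : Tendsto (fun j : ℕ => r (-j) * a ^ j) atTop (𝓝 C)
  lt_half : M * ∑' j, |r j| < 1 / 2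

namespace DigitKernel

variable {r : ℤ → ℝ} {M : ℤ} {a C : ℝ}

lemma digits_nonneg (h : DigitKernel r M a C) : 0 ≤ M := by
  have : (0 : ℝ) < M := by linarith [h.one_lt, h.lt_digits]
  exact_mod_cast this.le

lemma summable_neg (h : DigitKernel r M a C) : Summable fun i : ℕ => |r (-(i : ℤ))| := by
  simpa using summable_abs_shift h.summable 0 0

lemma eventually_tail (h : DigitKernel r M a C) : ∃ J : ℕ, ∀ j : ℕ, J ≤ j →
    r (-(j : ℤ)) ≠ 0 ∧ |r (-(j : ℤ))| ≤ 2 * (M * ∑' k : ℕ, |r (-((j + 1 + k : ℕ) : ℤ))|) :=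
  eventually_atTop.1 (eventually_le_tail (f := fun j : ℕ => r (-(j : ℤ))) h.summable_neg h.one_lt
    h.lt_digits h.ne_zero h.lim)

/-- Kakeya's criterion holds for all sufficiently far tails. The factor `2 * M + 1` limits how much
the reach of a tail shrinks in one step, so some tail has reach comparable to any given small
number. -/
lemma exists_far_digits (h : DigitKernel r M a C) : ∃ J : ℕ, ∀ n N : ℤ, J ≤ N - n →
    r (n - N) ≠ 0 ∧
    M * ∑' i : ℕ, |r (n - (N + i))| ≤ (2 * M + 1) * (M * ∑' i : ℕ, |r (n - (N + 1 + i))|) ∧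
    |r (n - N)| ≤ 2 * (M * ∑' i : ℕ, |r (n - (N + 1 + i))|) ∧
    ∀ y : ℝ, |y| ≤ M * ∑' i : ℕ, |r (n - (N + i))| → ∃ t : ℕ → ℤ, (∀ i, |t i| ≤ M) ∧
      HasSum (fun i : ℕ => r (n - (N + i)) * t i) y := by
  obtain ⟨J, hJ⟩ := h.eventually_tail
  refine ⟨J, fun n N hN => ?_⟩
  have hM : (0 : ℝ) ≤ M := by exact_mod_cast h.digits_nonneg
  have key : ∀ i : ℕ, r (n - (N + i)) ≠ 0 ∧
      |r (n - (N + i))| ≤ 2 * (M * ∑' k : ℕ, |r (n - (N + (i + 1 + k : ℕ)))|) := by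
    intro i
    have := hJ (N + i - n).toNat (by omega)
    have e1 : -((N + i - n).toNat : ℤ) = n - (N + i) := by omega
    have e2 : ∀ k : ℕ, -(((N + i - n).toNat + 1 + k : ℕ) : ℤ) = n - (N + (i + 1 + k : ℕ)) := by
      intro k; omega
    simpa only [e1, e2] using this
  have key0 := key 0
  have e3 : ∀ k : ℕ, N + ((0 + 1 + k : ℕ) : ℤ) = N + 1 + k := by intro k; push_cast; ring
  simp only [Nat.cast_zero, add_zero, e3] at key0
  refine ⟨key0.1, ?_, key0.2, fun y hy => ?_⟩
  · rw [(summable_abs_shift h.summable n N).tsum_eq_zero_add]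
    have e4 : ∀ k : ℕ, N + ((k + 1 : ℕ) : ℤ) = N + 1 + k := by intro k; push_cast; ring
    simp only [Nat.cast_zero, add_zero, e4]
    nlinarith [key0.2]
  · exact exists_hasSum_digits h.digits_nonneg (summable_abs_shift h.summable n N)
      (fun i => (key i).2) hy

/-- There is a sequence with exceptional digit at `m` only at which the value `1 / 2` is hit. -/
lemma exists_base (h : DigitKernel r M a C) : ∃ (m c : ℤ) (s : ℤ → ℤ), s m = c ∧
    (∀ j, j ≠ m → |s j| ≤ M) ∧ distInt (convInt r s 0) = 1 / 2 := by
  obtain ⟨J, hJ⟩ := h.exists_far_digits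
  have hM : (0 : ℝ) ≤ M := by exact_mod_cast h.digits_nonneg
  obtain ⟨h0, -, h1, -⟩ := hJ 0 J (by omega)
  obtain ⟨-, -, -, h3⟩ := hJ 0 (J + 1) (by omega)
  set f := r (0 - J) with hf
  -- The best approximation of `1/2` by a multiple of `f` misses by at most `|f| / 2`, which the
  -- digits after `J` can make up.
  set c := round (1 / 2 / f) with hc
  have h4 : |1 / 2 - c * f| ≤ |f| / 2 := by
    have e : 1 / 2 - c * f = (1 / 2 / f - c) * f := by field_simp
    rw [e, abs_mul]
    have := abs_sub_round (1 / 2 / f)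
    have := mul_le_mul_of_nonneg_right this (abs_nonneg f)
    linarith
  obtain ⟨t, ht, hsum⟩ := h3 (1 / 2 - c * f) (by linarith)
  refine ⟨J, c, replaceTail (Pi.single (J : ℤ) c) (J + 1) t, ?_, ?_, ?_⟩
  · simp [replaceTail]
  · intro j hj
    unfold replaceTail
    split_ifs
    · simpa [Pi.single_eq_of_ne hj] using h.digits_nonneg
    · exact ht _
  · have hb1 : ∀ j, |((Pi.single (J : ℤ) c : ℤ → ℤ) j : ℝ)| ≤ max |(c : ℝ)| M := by
      intro j
      by_cases hj : j = J
      · subst hj; simp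
      · simp [Pi.single_eq_of_ne hj, hM]
    have hb2 : ∀ j, |(t j : ℝ)| ≤ max |(c : ℝ)| M := fun j =>
      le_max_of_le_right (by exact_mod_cast ht j)
    rw [convInt_replaceTail h.summable hb1 hb2]
    have e1 : convInt r (Pi.single (J : ℤ) c) 0 = f * c := by
      rw [convInt, tsum_eq_single (J : ℤ)]
      · simp [hf]
      · intro j hj; simp [Pi.single_eq_of_ne hj]
    have e2 : ∀ i : ℕ, (Pi.single (J : ℤ) c : ℤ → ℤ) (J + 1 + i) = 0 := fun i =>
      Pi.single_eq_of_ne (by omega) _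
    simp only [e1, e2, Int.cast_zero, sub_zero, hsum.tsum_eq]
    rw [mul_comm, add_sub_cancel, distInt_eq_abs] <;> norm_num [abs_of_pos]

/-- Away from finitely many places the values stay away from `1 / 2`. -/
lemma exists_far_bound (h : DigitKernel r M a C) (m c : ℤ) : ∃ (F : Finset ℤ) (v : ℝ), v < 1 / 2 ∧
    M * ∑' j, |r j| ≤ v ∧
    ∀ s : ℤ → ℤ, s m = c → (∀ j, j ≠ m → |s j| ≤ M) → ∀ n ∉ F, |convInt r s n| ≤ v := by
  set A := ∑' j, |r j|
  have hM : (0 : ℝ) ≤ M := by exact_mod_cast h.digits_nonneg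
  have hA := h.lt_half
  have ht : Tendsto (fun n => |(c : ℝ)| * |r (n - m)|) cofinite (𝓝 0) := by
    have := ((Equiv.subRight m).summable_iff.2 h.summable).tendsto_cofinite_zero.const_mul |(c : ℝ)|
    simpa using this
  have hev := ht.eventually (gt_mem_nhds (show 0 < (1 / 2 - M * A) / 2 by linarith))
  rw [eventually_cofinite] at hev
  -- Outside `F` the exceptional digit contributes less than half of the gap `1/2 - M A`. Both `F`
  -- and `v` depend on `m` and `c` only, so they survive a change of the other digits.
  refine ⟨hev.toFinset, (M * A + 1 / 2) / 2, by linarith, by linarith, fun s hm hs n hn => ?_⟩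
  simp only [Set.Finite.mem_toFinset, Set.mem_ofPred_eq, not_not] at hn
  have hsum1 : HasSum (fun j => |r (n - j)| * M) (A * M) := by
    have := (summable_abs_sub h.summable n).hasSum.mul_right (M : ℝ)
    rwa [tsum_abs_sub] at this
  have hsum2 : HasSum (fun j => if j = m then |(c : ℝ)| * |r (n - m)| else 0)
      (|(c : ℝ)| * |r (n - m)|) := hasSum_ite_eq _ _
  have hsum := hsum1.add hsum2
  have := abs_tsum_le_of_summable (f := fun j => r (n - j) * s j) hsum.summable fun j => ?_
  · rw [hsum.tsum_eq] at this
    unfold convInt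
    linarith
  · rw [abs_mul]
    by_cases hj : j = m
    · subst hj
      rw [if_pos rfl, hm]
      nlinarith [mul_nonneg (abs_nonneg (r (n - j))) hM]
    · rw [if_neg hj, add_zero]
      gcongr
      exact_mod_cast hs j hj

/-- A change of a far tail acts at `n` about `a ^ (n - n')` times as strongly as at `n'`. Hence the
leftmost place with value `1/2` is the one that moves least. -/
lemma eventually_shift_ratio (h : DigitKernel r M a C) {n n' : ℤ} (hn : n' ≤ n) {ω : ℝ}
    (hω : 0 < ω) : ∃ N₀ : ℕ, ∀ N : ℕ, N₀ ≤ N → ∀ i : ℕ,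
      |r (n - (N + i)) - a ^ (n - n').toNat * r (n' - (N + i))| ≤ ω * |r (n' - (N + i))| := by
  have ha : a ≠ 0 := abs_pos.1 (by linarith [h.one_lt])
  obtain ⟨J, hJ⟩ := eventually_atTop.1
    (eventually_ratio (f := fun j : ℕ => r (-(j : ℤ))) ha h.ne_zero h.lim (n - n').toNat hω)
  refine ⟨J + n.toNat, fun N hN i => ?_⟩
  have := hJ (N + i - n).toNat (by omega)
  have e1 : -((N + i - n).toNat : ℤ) = n - (N + i) := by omega
  have e2 : -(((N + i - n).toNat + (n - n').toNat : ℕ) : ℤ) = n' - (N + i) := by omega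
  simpa only [e1, e2] using this

/-- Changing a far tail, one can lower the maximal value `1 / 2` by any small amount. -/
theorem exists_interval (h : DigitKernel r M a C) : ∃ v : ℝ, v < 1 / 2 ∧ M * ∑' j, |r j| ≤ v ∧
    ∀ y ∈ Set.Icc v (1 / 2), ∃ s : ℤ → ℤ, (∃ m, ∀ j, j ≠ m → |s j| ≤ M) ∧
      ∃ n₀, distInt (convInt r s n₀) = y ∧ ∀ n, distInt (convInt r s n) ≤ y := by
  obtain ⟨m, c, s, hsm, hs, hs0⟩ := h.exists_base
  obtain ⟨F, v, hv, hMv, hF⟩ := h.exists_far_bound m c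
  obtain ⟨J, hJ⟩ := h.exists_far_digits
  have hM : (0 : ℝ) ≤ M := by exact_mod_cast h.digits_nonneg
  have ha := h.one_lt
  -- the places with value `1 / 2`, the first one `n₁`, and a gap `2 η` for the other ones
  let E := F.filter fun n => distInt (convInt r s n) = 1 / 2
  have hE : ∀ n, n ∈ E ↔ n ∈ F ∧ distInt (convInt r s n) = 1 / 2 := fun n => Finset.mem_filter
  have h0E : (0 : ℤ) ∈ E := by
    rw [hE]
    refine ⟨?_, hs0⟩
    by_contra h0
    have := (distInt_le_abs _).trans (hF s hsm hs 0 h0)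
    linarith
  set n₁ := E.min' ⟨0, h0E⟩ with hn₁
  have hn₁E : n₁ ∈ E := E.min'_mem _
  have hn₁le : ∀ n ∈ E, n₁ ≤ n := fun n hn => E.min'_le n hn
  obtain ⟨η, hη, hη', hgap⟩ : ∃ η : ℝ, 0 < η ∧ η ≤ 1 / 2 ∧
      ∀ n ∈ F, n ∉ E → distInt (convInt r s n) ≤ 1 / 2 - 2 * η := by
    have : ∀ᶠ η in 𝓝[>] (0 : ℝ), ∀ n ∈ F, n ∉ E → distInt (convInt r s n) ≤ 1 / 2 - 2 * η := by
      rw [Finset.eventually_all]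
      intro n hn
      by_cases hnE : n ∈ E
      · exact Eventually.of_forall fun _ h => absurd hnE h
      · have hlt : distInt (convInt r s n) < 1 / 2 :=
          lt_of_le_of_ne (distInt_le_half _) fun h' => hnE ((hE n).2 ⟨hn, h'⟩)
        have ht : Tendsto (fun η : ℝ => 1 / 2 - 2 * η) (𝓝[>] 0) (𝓝 (1 / 2 - 2 * 0)) :=
          tendsto_nhdsWithin_of_tendsto_nhds (Continuous.tendsto (by fun_prop) 0)
        filter_upwards [ht.eventually (lt_mem_nhds (by simpa using hlt))] with η hη _ using hη.le
    obtain ⟨η, h1, h2, h3⟩ := (this.and (Ioc_mem_nhdsGT (show (0 : ℝ) < 1 / 2 by norm_num))).exists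
    exact ⟨η, h2, h3, h1⟩
  -- Chosen so that, once `R N ≤ (2 * M + 1) * z`, the total error `2 * ω * R N` is at most `(|a| -
  -- 1) * z`, the surplus of `|a| * z` over `z`.
  set ω : ℝ := (|a| - 1) / (2 * (2 * M + 1)) with hω
  have hωpos : 0 < ω := div_pos (by linarith) (by linarith)
  have hωM : 2 * ω * (2 * M + 1) = |a| - 1 := by rw [hω]; field_simp
  -- a place from which on tails may be changed
  obtain ⟨N₀, hN₀⟩ : ∃ N₀ : ℕ, ∀ N : ℕ, N₀ ≤ N → (m < N ∧ (J : ℤ) ≤ N - n₁) ∧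
      (∀ n ∈ F, 2 * (M * ∑' i : ℕ, |r (n - ((N : ℤ) + i))|) ≤ η) ∧
      ∀ n ∈ E, ∀ i : ℕ, |r (n - (N + i)) - a ^ (n - n₁).toNat * r (n₁ - (N + i))| ≤
        ω * |r (n₁ - (N + i))| := by
    rw [← eventually_atTop]
    refine Eventually.and ?_ (Eventually.and ?_ ?_)
    · filter_upwards [eventually_ge_atTop (m.toNat + 1 + J + n₁.toNat)] with N hN
      omega
    · rw [Finset.eventually_all]
      intro n _
      have := (tendsto_tail r M n).const_mul 2
      rw [mul_zero] at this
      exact (this.eventually (gt_mem_nhds hη)).mono fun _ h => h.le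
    · rw [Finset.eventually_all]
      intro n hn
      exact eventually_atTop.2 (h.eventually_shift_ratio (hn₁le n hn) hωpos)
  set R : ℕ → ℝ := fun N => M * ∑' i : ℕ, |r (n₁ - ((N : ℤ) + i))| with hR
  have hRpos : 0 < R N₀ := by
    have h1 := hJ n₁ N₀ (hN₀ N₀ le_rfl).1.2
    have h2 : 0 < |r (n₁ - N₀)| := abs_pos.2 h1.1
    by_contra hneg
    have h3 := (summable_abs_shift h.summable n₁ N₀).tsum_eq_zero_add
    have h4 : 0 ≤ ∑' i : ℕ, |r (n₁ - (N₀ + 1 + i))| := tsum_nonneg fun _ => abs_nonneg _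
    have h5 : (0 : ℝ) < M := by linarith [h.lt_digits]
    have h6 : ∑' i : ℕ, |r (n₁ - ((N₀ : ℤ) + (i + 1 : ℕ)))| =
        ∑' i : ℕ, |r (n₁ - (N₀ + 1 + i))| :=
      tsum_congr fun i => by congr 2; push_cast; ring
    rw [h6] at h3
    simp only [Nat.cast_zero, add_zero] at h3
    exact hneg (mul_pos h5 (by linarith))
  have hsb : ∀ j, |(s j : ℝ)| ≤ max |(c : ℝ)| M := by
    intro j
    by_cases hj : j = m
    · rw [hj, hsm]; exact le_max_left _ _
    · exact le_max_of_le_right (by exact_mod_cast hs j hj)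
  refine ⟨1 / 2 - min (min (R N₀) η) (1 / 2 - v), ?_, ?_, fun y hy => ?_⟩
  · have : 0 < min (min (R N₀) η) (1 / 2 - v) := by
      refine lt_min (lt_min hRpos hη) ?_
      linarith
    linarith
  · have := min_le_right (min (R N₀) η) (1 / 2 - v)
    linarith
  obtain ⟨hy1, hy2⟩ := hy
  rcases hy2.eq_or_lt with rfl | hy2
  · exact ⟨s, ⟨m, hs⟩, 0, hs0, fun n => distInt_le_half _⟩
  set z := 1 / 2 - y with hz
  have hzpos : 0 < z := by linarith
  have hzle : z ≤ min (min (R N₀) η) (1 / 2 - v) := by linarith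
  have hzη : z ≤ η := hzle.trans ((min_le_left _ _).trans (min_le_right _ _))
  have hzv : z ≤ 1 / 2 - v := hzle.trans (min_le_right _ _)
  have hzR : z ≤ R N₀ := hzle.trans ((min_le_left _ _).trans (min_le_left _ _))
  -- The tail is cut just before its reach drops below `z`, so that `R N` is comparable to `z`.
  obtain ⟨N, hN, hzN, hzN'⟩ : ∃ N, N₀ ≤ N ∧ z ≤ R N ∧ R (N + 1) < z := by
    have hex : ∃ k, R (N₀ + k) < z := by
      have := ((tendsto_tail r M n₁).eventually (gt_mem_nhds hzpos)).and (eventually_ge_atTop N₀)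
      obtain ⟨N, h1, h2⟩ := this.exists
      exact ⟨N - N₀, by rw [Nat.add_sub_cancel' h2]; exact h1⟩
    classical
    have h1 := Nat.find_spec hex
    have h2 : Nat.find hex ≠ 0 := fun h0 => by
      rw [h0] at h1; simp only [add_zero] at h1; linarith
    obtain ⟨k, hk⟩ := Nat.exists_eq_succ_of_ne_zero h2
    refine ⟨N₀ + k, by omega, not_lt.1 (Nat.find_min hex (m := k) (by omega)), ?_⟩
    rw [hk] at h1
    exact h1
  obtain ⟨⟨hmN, hJN⟩, hNF, hNE⟩ := hN₀ N hN
  obtain ⟨-, hRR, -, hdig⟩ := hJ n₁ N hJN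
  have hRR' : R N ≤ (2 * M + 1) * z := by
    have e : M * ∑' i : ℕ, |r (n₁ - (N + 1 + i))| = R (N + 1) := by simp [hR]
    rw [e] at hRR
    have : 0 ≤ 2 * (M : ℝ) + 1 := by linarith
    nlinarith
  have hsN : ∀ i : ℕ, |s (N + i)| ≤ M := fun i => hs _ (by omega)
  set T := ∑' i : ℕ, r (n₁ - (N + i)) * s (N + i) with hT
  have hTsum : Summable fun i : ℕ => r (n₁ - (N + i)) * (s (N + i) : ℝ) :=
    (summable_convInt h.summable hsb n₁).comp_injective
      (i := fun i : ℕ => (N : ℤ) + (i : ℤ)) fun i j h => by simpa using h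
  have hTle : |T| ≤ R N := by
    have h1 := (summable_abs_shift h.summable n₁ N).mul_left (M : ℝ)
    have h2 := abs_tsum_le_of_summable (f := fun i : ℕ => r (n₁ - (N + i)) * (s (N + i) : ℝ)) h1
      fun i => ?_
    · rwa [tsum_mul_left] at h2
    · rw [abs_mul, mul_comm]
      gcongr
      exact_mod_cast hsN i
  -- Moving off `1/2` in either direction lowers the distance equally, so the sign of `w` is free;
  -- opposite to `T` it keeps the new tail sum representable.
  obtain ⟨w, hw, hTw⟩ : ∃ w : ℝ, |w| = z ∧ |T + w| ≤ R N := by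
    have hT' := abs_le.1 hTle
    rcases le_total T 0 with h0 | h0
    · exact ⟨z, abs_of_pos hzpos, abs_le.2 ⟨by linarith, by linarith⟩⟩
    · exact ⟨-z, by rw [abs_neg, abs_of_pos hzpos], abs_le.2 ⟨by linarith, by linarith⟩⟩
  obtain ⟨t, ht, hsum⟩ := hdig _ hTw
  have htb : ∀ j, |(t j : ℝ)| ≤ max |(c : ℝ)| M := fun j =>
    le_max_of_le_right (by exact_mod_cast ht j)
  set D : ℤ → ℝ := fun n => ∑' i : ℕ, r (n - (N + i)) * ((t i : ℝ) - s (N + i)) with hD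
  have hconv : ∀ n, convInt r (replaceTail s N t) n = convInt r s n + D n := fun n =>
    convInt_replaceTail h.summable hsb htb N n
  have hΔ : ∀ i : ℕ, |(t i : ℝ) - s (N + i)| ≤ 2 * M := fun i => by
    have h1 : |(t i : ℝ)| ≤ M := by exact_mod_cast ht i
    have h2 : |(s (N + i) : ℝ)| ≤ M := by exact_mod_cast hsN i
    exact (abs_sub _ _).trans (by linarith)
  have hD1 : D n₁ = w := by
    simp only [hD, mul_sub]
    rw [hsum.summable.tsum_sub hTsum, hsum.tsum_eq, ← hT]
    ring
  have hDF : ∀ n ∈ F, |D n| ≤ η := by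
    intro n hn
    refine le_trans ?_ (hNF n hn)
    have h1 := (summable_abs_shift h.summable n N).mul_left (2 * (M : ℝ))
    rw [← mul_assoc, ← tsum_mul_left]
    refine abs_tsum_le_of_summable h1 fun i => ?_
    rw [abs_mul, mul_comm]
    gcongr
    exact hΔ i
  have hDsum : ∀ n, Summable fun i : ℕ => r (n - (N + i)) * ((t i : ℝ) - s (N + i)) := by
    intro n
    refine Summable.of_norm_bounded ((summable_abs_shift h.summable n N).mul_left (2 * (M : ℝ)))
      fun i => ?_
    rw [Real.norm_eq_abs, abs_mul, mul_comm]
    gcongr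
    exact hΔ i
  have hDE : ∀ n ∈ E, z ≤ |D n| := by
    intro n hn
    rcases (hn₁le n hn).eq_or_lt with rfl | hlt
    · rw [hD1, hw]
    set e := (n - n₁).toNat with he
    have he1 : 1 ≤ e := by omega
    have h1 : |D n - a ^ e * w| ≤ 2 * ω * R N := by
      rw [← hD1]
      simp only [hD]
      rw [← tsum_mul_left, ← (hDsum n).tsum_sub ((hDsum n₁).mul_left _)]
      have h2 := (summable_abs_shift h.summable n₁ N).mul_left (2 * ω * (M : ℝ))
      have h3 := abs_tsum_le_of_summable (f := fun i : ℕ =>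
        r (n - (N + i)) * ((t i : ℝ) - s (N + i)) -
          a ^ e * (r (n₁ - (N + i)) * ((t i : ℝ) - s (N + i)))) h2 fun i => ?_
      · rw [tsum_mul_left] at h3
        simpa [hR, mul_assoc] using h3
      · have e1 : r (n - (N + i)) * ((t i : ℝ) - s (N + i)) -
            a ^ e * (r (n₁ - (N + i)) * ((t i : ℝ) - s (N + i))) =
            (r (n - (N + i)) - a ^ e * r (n₁ - (N + i))) * ((t i : ℝ) - s (N + i)) := by ring
        rw [e1, abs_mul]
        refine (mul_le_mul (hNE n hn i) (hΔ i) (abs_nonneg _) (by positivity)).trans (le_of_eq ?_)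
        ring
    have h2 : |a| * z ≤ |a ^ e * w| := by
      rw [abs_mul, abs_pow, hw]
      gcongr
      exact le_self_pow₀ ha.le (by omega)
    have h3 : 2 * ω * R N ≤ (|a| - 1) * z := by
      rw [← hωM, mul_assoc (2 * ω)]
      gcongr
    have h4 := abs_sub_abs_le_abs_sub (a ^ e * w) (D n)
    rw [abs_sub_comm] at h4
    linarith
  have hval : ∀ n ∈ E, distInt (convInt r (replaceTail s N t) n) = 1 / 2 - |D n| := by
    intro n hn
    rw [hconv, distInt_add_of_half ((hE n).1 hn).2]
    exact (hDF n ((hE n).1 hn).1).trans hη'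
  have hcl : ∀ j, j ≠ m → |replaceTail s N t j| ≤ M := by
    intro j hj
    unfold replaceTail
    split_ifs
    exacts [hs j hj, ht _]
  refine ⟨replaceTail s N t, ⟨m, hcl⟩, n₁, ?_, fun n => ?_⟩
  · rw [hval n₁ hn₁E, hD1, hw, hz]; ring
  -- Places in `E` drop by at least `z`; those in `F` but not in `E` stay below `1/2 - 2η + η ≤ y`;
  -- outside `F` the bound `v ≤ y` applies.
  · by_cases hnF : n ∈ F
    · by_cases hnE : n ∈ E
      · rw [hval n hnE]
        linarith [hDE n hnE]
      · have h1 := hgap n hnF hnE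
        have h2 := distInt_le_add (convInt r (replaceTail s N t) n) (convInt r s n)
        rw [hconv, add_sub_cancel_left] at h2
        rw [hconv]
        linarith [hDF n hnF]
    · have := (distInt_le_abs _).trans (hF (replaceTail s N t) (by simp [replaceTail, hmN, hsm])
        hcl n hnF)
      linarith

end DigitKernel

/-! ### From maxima over two-sided sequences to limits superior of one-sided ones. -/

/-- Bounded sequences which agree on a large finite set have almost the same weighted sums. -/
lemma exists_finset_abs_tsum_sub_le {ι : Type*} {r : ι → ℝ} (hr : Summable fun j => |r j|) {B : ℝ}
    (hB : 0 < B) {δ : ℝ} (hδ : 0 < δ) : ∃ T : Finset ι, ∀ x y : ι → ℝ, (∀ j, |x j| ≤ B) →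
      (∀ j, |y j| ≤ B) → (∀ j ∈ T, x j = y j) → |∑' j, r j * x j - ∑' j, r j * y j| ≤ δ := by
  have ht : Tendsto (fun T : Finset ι => ∑ j ∈ T, |r j|) atTop (𝓝 (∑' j, |r j|)) := by
    simpa [HasSum] using hr.hasSum
  obtain ⟨T, hT⟩ := (ht.eventually
    (lt_mem_nhds (show ∑' j, |r j| - δ / (2 * B) < ∑' j, |r j| by
      have : 0 < δ / (2 * B) := by positivity
      linarith))).exists
  refine ⟨T, fun x y hx hy hxy => ?_⟩
  classical
  have hs : ∀ x : ι → ℝ, (∀ j, |x j| ≤ B) → Summable fun j => r j * x j := fun x hx => by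
    refine Summable.of_norm_bounded (hr.mul_right B) fun j => ?_
    rw [Real.norm_eq_abs, abs_mul]
    gcongr
    exact hx j
  have hT' : HasSum (fun j => if j ∈ T then |r j| else 0) (∑ j ∈ T, |r j|) := by
    have : HasSum (fun j => if j ∈ T then |r j| else 0) (∑ j ∈ T, if j ∈ T then |r j| else 0) :=
      hasSum_sum_of_ne_finset_zero fun j hj => if_neg hj
    rwa [Finset.sum_congr rfl fun j hj => if_pos hj] at this
  have hsum := (hr.hasSum.sub hT').mul_left (2 * B)
  rw [← (hs x hx).tsum_sub (hs y hy)]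
  refine (abs_tsum_le_of_summable hsum.summable fun j => ?_).trans ?_
  · rw [← mul_sub, abs_mul]
    by_cases hj : j ∈ T
    · simp [hj, hxy j hj]
    · rw [if_neg hj, sub_zero, mul_comm]
      gcongr
      exact (abs_sub _ _).trans (by linarith [hx j, hy j])
  · rw [hsum.tsum_eq]
    have : 2 * B * (δ / (2 * B)) = δ := by field_simp
    nlinarith

/-- The concatenation of the blocks `s (-k), …, s k` for `k = 0, 1, 2, …`. -/
def blocks (s : ℤ → ℤ) (n : ℕ) : ℤ := s (n - n.sqrt ^ 2 - n.sqrt)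

/-- Block `k` occupies `k², …, k² + 2k`, the integers with `⌊√n⌋ = k`, and is centred at `k² + k`.
-/
lemma blocks_apply (s : ℤ → ℤ) {n k : ℕ} {p : ℤ} (h : (n : ℤ) = k ^ 2 + k + p) (h₁ : -k ≤ p)
    (h₂ : p ≤ k) : blocks s n = s p := by
  have : n.sqrt = k := by
    rw [eq_comm, Nat.eq_sqrt]
    constructor <;> zify <;> nlinarith
  rw [blocks, this, h]
  congr 1
  ring

lemma exists_block (n : ℕ) : ∃ (k : ℕ) (p : ℤ), (n : ℤ) = k ^ 2 + k + p ∧ -k ≤ p ∧ p ≤ k := by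
  refine ⟨n.sqrt, n - n.sqrt ^ 2 - n.sqrt, by ring, ?_, ?_⟩
  · have : (n.sqrt : ℤ) ^ 2 ≤ n := by exact_mod_cast Nat.sqrt_le' n
    linarith
  · have h := Nat.sqrt_le_add n
    zify at h
    linarith

/-- Around a far place, `blocks s` looks like `s` or only contains values of `s` at far places. -/
lemma blocks_dichotomy (s : ℤ → ℤ) (K L : ℕ) : ∃ n₁ : ℕ, ∀ n : ℕ, n₁ ≤ n →
    (∃ p : ℤ, ∀ j : ℤ, |j| ≤ L → blocks s (n - j).toNat = s (p - j)) ∨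
    ∀ j : ℤ, |j| ≤ L → ∃ p : ℤ, K ≤ |p| ∧ blocks s (n - j).toNat = s p := by
  refine ⟨L + (K + 2 * L + 1) ^ 2 + (K + 2 * L + 1), fun n hn => ?_⟩
  -- Near a block centre, the lower bound on `n` forces `k ≥ K + 2L`, so the window of radius `L`
  -- lies inside one block. Away from all centres, no position in the window is within `K` of a
  -- centre.
  by_cases h : ∃ (k : ℕ) (q : ℤ), (n : ℤ) = k ^ 2 + k + q ∧ |q| ≤ K + L
  · obtain ⟨k, q, hq, hqK⟩ := h
    left
    refine ⟨q, fun j hj => ?_⟩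
    have hk : K + 2 * L ≤ k := by
      by_contra hk
      push Not at hk
      have h1 := (abs_le.1 hqK).2
      zify at hn hk
      nlinarith
    rw [abs_le] at hj hqK
    have hpos : 0 ≤ (n : ℤ) - j := by zify at hn; nlinarith
    apply blocks_apply s (k := k)
    · rw [Int.toNat_of_nonneg hpos, hq]; ring
    · zify at hk; linarith
    · zify at hk; linarith
  · right
    intro j hj
    obtain ⟨k, p, hp, h1, h2⟩ := exists_block (n - j).toNat
    refine ⟨p, ?_, blocks_apply s hp h1 h2⟩
    by_contra hpK
    push Not at hpK
    refine h ⟨k, p + j, ?_, (abs_add_le _ _).trans (by linarith)⟩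
    have hpos : 0 ≤ (n : ℤ) - j := by rw [abs_le] at hj; zify at hn; nlinarith
    rw [Int.toNat_of_nonneg hpos] at hp
    linarith

/-- The supremum of the distances to the nearest integer attached to a two-sided sequence is the
limes superior attached to a one-sided sequence. -/
theorem exists_limsup_distInt_eq {r : ℤ → ℝ} (hr : Summable fun j => |r j|) {M : ℤ} (hM : 0 ≤ M)
    {s : ℤ → ℤ} {m : ℤ} (hs : ∀ j, j ≠ m → |s j| ≤ M) {y : ℝ} (hy : M * ∑' j, |r j| ≤ y) {n₀ : ℤ}
    (hn₀ : distInt (convInt r s n₀) = y) (hle : ∀ n, distInt (convInt r s n) ≤ y) :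
    ∃ (t : ℕ → ℤ) (B : ℝ), (∀ j, |(t j : ℝ)| ≤ B) ∧
      limsup (fun n : ℕ => distInt (∑' j : ℕ, r (n - j) * t j)) atTop = y := by
  have hM' : (0 : ℝ) ≤ M := by exact_mod_cast hM
  set B : ℝ := |(s m : ℝ)| + M + 1
  have hB : 0 < B := by positivity
  have hsB : ∀ j, |(s j : ℝ)| ≤ B := by
    intro j
    by_cases hj : j = m
    · rw [hj]; linarith
    · have : |(s j : ℝ)| ≤ M := by exact_mod_cast hs j hj
      linarith [abs_nonneg (s m : ℝ)]
  refine ⟨blocks s, B, fun j => hsB _, ?_⟩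
  let S : ℤ → ℤ := fun j => if j < 0 then 0 else blocks s j.toNat
  have hSB : ∀ j, |(S j : ℝ)| ≤ B := by
    intro j
    simp only [S]
    split_ifs
    · simpa using hB.le
    · exact hsB _
  have hS : ∀ n : ℕ, ∑' j : ℕ, r (n - j) * (blocks s j : ℝ) = convInt r S n := by
    intro n
    rw [convInt, ← Nat.cast_injective.tsum_eq (f := fun j : ℤ => r (n - j) * (S j : ℝ))]
    · simp [S, show ∀ i : ℕ, ¬ (i : ℤ) < 0 from fun i => by omega]
    · intro j hj
      by_contra h
      have : j < 0 := by
        by_contra h'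
        exact h ⟨j.toNat, by omega⟩
      simp [S, this] at hj
  simp_rw [hS]
  have hfin : ∀ T : Finset ℤ, ∃ L : ℕ, ∀ j ∈ T, |j| ≤ L := fun T =>
    ⟨T.sup Int.natAbs, fun j hj => by
      have := Finset.le_sup (f := Int.natAbs) hj
      rw [Int.abs_eq_natAbs]
      omega⟩
  apply limsup_distInt_eq
  · intro δ hδ
    obtain ⟨T, hT⟩ := exists_finset_abs_tsum_sub_le hr hB hδ
    obtain ⟨L, hL⟩ := hfin T
    -- With this radius, a window of the second kind never contains the exceptional digit `s m`, so
    -- the bound `M * ∑ |r j| ≤ y` applies to it.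
    obtain ⟨n₁, hn₁⟩ := blocks_dichotomy s (m.natAbs + 1) L
    filter_upwards [eventually_ge_atTop (n₁ + L)] with n hn
    have hSn : ∀ j : ℤ, |j| ≤ L → S (n - j) = blocks s (n - j).toNat := fun j hj => by
      rw [abs_le] at hj
      exact if_neg (by omega)
    rcases hn₁ n (by omega) with ⟨p, hp⟩ | hfar
    · have h1 := hT (fun j => S (n - j)) (fun j => s (p - j)) (fun j => hSB _) (fun j => hsB _)
        fun j hj => by rw [hSn j (hL j hj), hp j (hL j hj)]
      rw [← convInt_eq_tsum, ← convInt_eq_tsum] at h1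
      exact (distInt_le_add _ _).trans (add_le_add (hle p) h1)
    · classical
      let x : ℤ → ℝ := fun j => if j ∈ T then S (n - j) else 0
      have hxM : ∀ j, |x j| ≤ M := by
        intro j
        simp only [x]
        split_ifs with hj
        · obtain ⟨p, hp1, hp2⟩ := hfar j (hL j hj)
          rw [hSn j (hL j hj), hp2]
          have : |s p| ≤ M := hs p (by rintro rfl; rw [Int.abs_eq_natAbs] at hp1; omega)
          exact_mod_cast this
        · simpa using hM'
      have h1 := hT (fun j => S (n - j)) x (fun j => hSB _)
        (fun j => (hxM j).trans (by linarith [abs_nonneg (s m : ℝ)])) fun j hj => by simp [x, hj]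
      rw [← convInt_eq_tsum] at h1
      have h2 : |∑' j, r j * x j| ≤ y := by
        refine (abs_tsum_le_of_summable (hr.mul_left (M : ℝ)) fun j => ?_).trans ?_
        · rw [abs_mul, mul_comm]
          gcongr
          exact hxM j
        · rwa [tsum_mul_left]
      exact (distInt_le_add _ (∑' j, r j * x j)).trans
        (add_le_add ((distInt_le_abs _).trans h2) h1)
  · intro δ hδ
    obtain ⟨T, hT⟩ := exists_finset_abs_tsum_sub_le hr hB hδ
    obtain ⟨L, hL⟩ := hfin T
    rw [frequently_atTop]
    intro n₁
    -- The block is long enough for the window around its position `n₀` to lie inside it.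
    let k : ℕ := n₁ + L + n₀.natAbs
    have hk0 : (k : ℤ) = n₁ + L + n₀.natAbs := by simp [k]
    have hpos : 0 ≤ (k : ℤ) ^ 2 + k + n₀ := by
      have : 0 ≤ (k : ℤ) ^ 2 := by positivity
      omega
    have hge : (k : ℤ) ^ 2 ≥ k := by exact_mod_cast Nat.le_self_pow two_ne_zero k
    obtain ⟨n, hn⟩ := Int.eq_ofNat_of_zero_le hpos
    refine ⟨n, by omega, ?_⟩
    have h1 := hT (fun j => s (n₀ - j)) (fun j => S (n - j)) (fun j => hsB _) (fun j => hSB _)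
      fun j hj => by
        have hj' := abs_le.1 (hL j hj)
        simp only [S]
        rw [if_neg (by omega)]
        congr 1
        refine (blocks_apply s (k := k) ?_ (by omega) (by omega)).symm
        rw [Int.toNat_of_nonneg (by omega)]
        linarith
    rw [← convInt_eq_tsum, ← convInt_eq_tsum] at h1
    have := distInt_le_add (convInt r s n₀) (convInt r S n)
    linarith

/-! ### Roots, residues and the numbers `ρ_n`. -/

variable {P : ℤ[X]}

/-- The residue `1 / P'(α)` of `1 / P` at a root `α`. -/
noncomputable def resInv (P : ℤ[X]) (α : ℂ) : ℂ := (aeval α (derivative P))⁻¹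

lemma mem_complexRoots (hP : P ≠ 0) {α : ℂ} : α ∈ complexRoots P ↔ aeval α P = 0 := by
  rw [complexRoots, Multiset.mem_toFinset, mem_aroots]
  simp [hP]

lemma aeval_conj_int (Q : ℤ[X]) (α : ℂ) :
    aeval (starRingEnd ℂ α) Q = starRingEnd ℂ (aeval α Q) :=
  aeval_algHom_apply (starRingEnd ℂ).toIntAlgHom α Q

lemma conj_mem_complexRoots (hP : P ≠ 0) {α : ℂ} (h : α ∈ complexRoots P) :
    starRingEnd ℂ α ∈ complexRoots P := by
  rw [mem_complexRoots hP] at h ⊢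
  rw [aeval_conj_int, h, map_zero]

lemma resInv_conj (P : ℤ[X]) (α : ℂ) : resInv P (starRingEnd ℂ α) = starRingEnd ℂ (resInv P α) := by
  rw [resInv, resInv, aeval_conj_int, map_inv₀]

lemma mem_expandingRoots {α : ℂ} : α ∈ expandingRoots P ↔ α ∈ complexRoots P ∧ 1 < ‖α‖ :=
  Finset.mem_filter

lemma mem_nonexpandingRoots {α : ℂ} :
    α ∈ nonexpandingRoots P ↔ α ∈ complexRoots P ∧ ‖α‖ ≤ 1 :=
  Finset.mem_filter

lemma sum_expandingRoots_add (P : ℤ[X]) (f : ℂ → ℂ) :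
    ∑ α ∈ expandingRoots P, f α + ∑ α ∈ nonexpandingRoots P, f α = ∑ α ∈ complexRoots P, f α := by
  rw [← Finset.sum_filter_add_sum_filter_not (complexRoots P) fun α => 1 < ‖α‖]
  simp only [not_lt]
  rfl

lemma Admissible.ne_zero_of_mem (hP : Admissible P) {α : ℂ} (h : α ∈ complexRoots P) : α ≠ 0 := by
  rintro rfl
  rw [mem_complexRoots hP.irreducible.ne_zero, ← coeff_zero_eq_aeval_zero'] at h
  exact hP.coeff_zero_ne (by simpa using h)

/-- This makes Lagrange interpolation at the roots available: the nodal weights are the residues,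
and partial fractions and Euler's formula are interpolation identities. -/
lemma Admissible.nodal_eq (hP : Admissible P) (hm : P.Monic) :
    Lagrange.nodal (complexRoots P) id = P.map (algebraMap ℤ ℂ) := by
  rw [(IsAlgClosed.splits (P.map (algebraMap ℤ ℂ))).eq_prod_roots_of_monic (hm.map _),
    Lagrange.nodal, complexRoots, Finset.prod_eq_multiset_prod, Multiset.toFinset_val,
    hP.nodup_roots.dedup]
  rfl

lemma Admissible.card_complexRoots (hP : Admissible P) (hm : P.Monic) :
    (complexRoots P).card = P.natDegree := by
  rw [← Lagrange.natDegree_nodal (v := (id : ℂ → ℂ)), hP.nodal_eq hm, hm.natDegree_map]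

lemma Admissible.nodalWeight_eq (hP : Admissible P) (hm : P.Monic) {α : ℂ}
    (h : α ∈ complexRoots P) : Lagrange.nodalWeight (complexRoots P) id α = resInv P α := by
  rw [Lagrange.nodalWeight_eq_eval_derivative_nodal h, hP.nodal_eq hm, resInv, derivative_map,
    eval_map_algebraMap]
  rfl

lemma Admissible.resInv_ne_zero (hP : Admissible P) (hm : P.Monic) {α : ℂ}
    (h : α ∈ complexRoots P) : resInv P α ≠ 0 := by
  rw [← hP.nodalWeight_eq hm h]
  exact Lagrange.nodalWeight_ne_zero (Set.injOn_id _) h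

lemma Admissible.nonempty (hP : Admissible P) (hm : P.Monic) : (complexRoots P).Nonempty := by
  rw [← Finset.card_pos, hP.card_complexRoots hm]
  exact hP.one_le_natDegree

/-- Partial fractions for `1 / P`. -/
lemma Admissible.inv_aeval (hP : Admissible P) (hm : P.Monic) {z : ℂ} (hz : z ∉ complexRoots P) :
    (aeval z P)⁻¹ = ∑ α ∈ complexRoots P, resInv P α * (z - α)⁻¹ := by
  have h1 := Lagrange.eval_interpolate_not_at_node (s := complexRoots P) (v := (id : ℂ → ℂ))
    (1 : ℂ → ℂ) (x := z) fun α hα h => hz (h ▸ hα)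
  rw [Lagrange.interpolate_one (Set.injOn_id _) (hP.nonempty hm), eval_one, hP.nodal_eq hm,
    eval_map_algebraMap] at h1
  rw [eq_comm, ← mul_eq_one_iff_eq_inv₀, mul_comm, h1]
  · congr 1
    exact Finset.sum_congr rfl fun α hα => by simp [hP.nodalWeight_eq hm hα]
  · rwa [Ne, ← mem_complexRoots hP.irreducible.ne_zero]

/-- Euler's formula: the sum of `Q(α) / P'(α)` over the roots is a coefficient of `Q` if
`deg Q < deg P`. -/
lemma Admissible.sum_resInv_mul (hP : Admissible P) (hm : P.Monic) {Q : ℤ[X]}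
    (hQ : Q.degree < P.degree) :
    ∑ α ∈ complexRoots P, resInv P α * aeval α Q = (Q.coeff (P.natDegree - 1) : ℂ) := by
  have h1 := Lagrange.coeff_eq_sum (s := complexRoots P) (v := (id : ℂ → ℂ)) (Set.injOn_id _)
    (P := Q.map (algebraMap ℤ ℂ)) ?_
  · rw [hP.card_complexRoots hm, coeff_map] at h1
    rw [← eq_intCast (algebraMap ℤ ℂ), h1]
    refine Finset.sum_congr rfl fun α hα => ?_
    rw [← hP.nodalWeight_eq hm hα, Lagrange.nodalWeight, Finset.prod_inv_distrib, div_eq_mul_inv,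
      mul_comm, id, eval_map_algebraMap]
  · rw [hP.card_complexRoots hm]
    exact degree_map_le.trans_lt (by rwa [degree_eq_natDegree hm.ne_zero] at hQ)

/-- The solution of the linear recurrence of `P` with initial values `0, …, 0, 1`. -/
noncomputable def impulse (P : ℤ[X]) (n : ℕ) : ℤ := (X ^ n %ₘ P).coeff (P.natDegree - 1)

/-- The source of integrality: at the roots `X ^ n` may be replaced by its remainder modulo the
monic `P`, to which Euler's formula applies. -/
lemma Admissible.sum_resInv_mul_pow (hP : Admissible P) (hm : P.Monic) (n : ℕ) :
    ∑ α ∈ complexRoots P, resInv P α * α ^ n = (impulse P n : ℂ) := by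
  rw [impulse, ← hP.sum_resInv_mul hm (degree_modByMonic_lt _ hm)]
  refine Finset.sum_congr rfl fun α hα => ?_
  have h := congrArg (aeval α) (modByMonic_add_div (X ^ n : ℤ[X]) P)
  rw [map_add, map_mul, (mem_complexRoots hm.ne_zero).1 hα, zero_mul, add_zero, map_pow,
    aeval_X] at h
  rw [h]

-- The identity `z ^ (n + 1) / (z - α) = z ^ n + α z ^ n / (z - α)` gives a recursion in both
-- directions from Cauchy's formula at `n = 0`. It jumps only at `n = -1`, which accounts for the
-- pole at 0.
open Classical in
lemma circleIntegral_zpow_mul_inv {α : ℂ} (hα : α ≠ 0) {R : ℝ} (hR : 0 < R) (hαR : ‖α‖ ≠ R)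
    (n : ℤ) : ∮ z in C(0, R), z ^ n * (z - α)⁻¹ = 2 * Real.pi * Complex.I * α ^ n *
      ((if ‖α‖ < R then 1 else 0) - if n < 0 then 1 else 0) := by
  have hz0 : ∀ z ∈ Metric.sphere (0 : ℂ) R, z ≠ 0 := by
    rintro z hz rfl
    simp at hz
    exact hR.ne hz
  have hzα : ∀ z ∈ Metric.sphere (0 : ℂ) R, z - α ≠ 0 := by
    intro z hz h
    rw [sub_eq_zero] at h
    subst h
    exact hαR (by simpa using hz)
  have hcont : ∀ n : ℤ, CircleIntegrable (fun z : ℂ => z ^ n) 0 R := fun n =>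
    ContinuousOn.circleIntegrable hR.le (continuousOn_id.zpow₀ n fun z hz => Or.inl (hz0 z hz))
  have hcont' : ∀ n : ℤ, CircleIntegrable (fun z : ℂ => z ^ n * (z - α)⁻¹) 0 R := fun n =>
    ContinuousOn.circleIntegrable hR.le ((continuousOn_id.zpow₀ n fun z hz =>
      Or.inl (hz0 z hz)).mul ((continuousOn_id.sub continuousOn_const).inv₀ hzα))
  have hstep : ∀ n : ℤ, ∮ z in C(0, R), z ^ (n + 1) * (z - α)⁻¹ =
      (if n = -1 then 2 * Real.pi * Complex.I else 0) +
        α * ∮ z in C(0, R), z ^ n * (z - α)⁻¹ := by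
    intro n
    have h1 : ∮ z in C(0, R), z ^ n = if n = -1 then 2 * Real.pi * Complex.I else 0 := by
      split_ifs with h
      · subst h
        simpa using circleIntegral.integral_sub_center_inv 0 hR.ne'
      · simpa using circleIntegral.integral_sub_zpow_of_ne h 0 0 R
    have h2 : CircleIntegrable (fun z : ℂ => α * (z ^ n * (z - α)⁻¹)) 0 R :=
      (hcont' n).const_fun_smul (a := α)
    rw [← h1, ← circleIntegral.integral_const_mul, ← circleIntegral.integral_add (hcont n) h2]
    refine circleIntegral.integral_congr hR.le fun z hz => ?_
    have := hzα z hz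
    simp only [zpow_add_one₀ (hz0 z hz)]
    field_simp
    ring
  have h0 : ∮ z in C(0, R), z ^ (0 : ℤ) * (z - α)⁻¹ =
      2 * Real.pi * Complex.I * (if ‖α‖ < R then 1 else 0) := by
    simp only [zpow_zero, one_mul]
    split_ifs with h
    · rw [circleIntegral.integral_sub_inv_of_mem_ball (by simpa using h), mul_one]
    · rw [mul_zero]
      refine Complex.circleIntegral_eq_zero_of_differentiable_on_off_countable hR.le
        Set.countable_empty ?_ ?_
      · refine (continuousOn_id.sub continuousOn_const).inv₀ fun z hz h' => ?_
        obtain rfl : z = α := sub_eq_zero.1 h'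
        exact h (lt_of_le_of_ne (by simpa using hz) hαR)
      · intro z hz
        refine (differentiableAt_id.sub_const _).inv fun h' => ?_
        obtain rfl : z = α := sub_eq_zero.1 h'
        exact h (by simpa using hz.1)
  induction n using Int.induction_on with
  | zero => rw [h0]; simp
  | succ n ih =>
    rw [hstep, ih, if_neg (show ¬ (n : ℤ) = -1 by omega), if_neg (show ¬ (n : ℤ) < 0 by omega),
      if_neg (show ¬ (n : ℤ) + 1 < 0 by omega), zpow_add_one₀ hα]
    ring
  | pred n ih =>
    have h1 := hstep (-n - 1)
    rw [sub_add_cancel, ih] at h1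
    apply mul_left_cancel₀ hα
    rw [← sub_eq_iff_eq_add'] at h1
    rw [← h1, if_pos (show -(n : ℤ) - 1 < 0 by omega), zpow_sub_one₀ hα]
    rcases Nat.eq_zero_or_pos n with rfl | hn
    · simp
      field_simp
      split_ifs <;> ring
    · rw [if_pos (show -(n : ℤ) < 0 by omega), if_neg (show ¬ -(n : ℤ) - 1 = -1 by omega)]
      field_simp
      ring

/-- The residue theorem for the numbers `ρ_n`. -/
theorem Admissible.rho_eq (hP : Admissible P) (hm : P.Monic) (n : ℤ) :
    rho P n = (∑ α ∈ expandingRoots P, resInv P α * α ^ (n - 1)) -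
      if 0 < n then (impulse P (n - 1).toNat : ℂ) else 0 := by
  have hev : ∀ᶠ R : ℝ in 𝓝[>] 1, ∮ z in C(0, R), z ^ (n - 1) / aeval z P =
      2 * Real.pi * Complex.I * (∑ α ∈ complexRoots P, resInv P α * (α ^ (n - 1) *
        ((if ‖α‖ ≤ 1 then 1 else 0) - if n - 1 < 0 then 1 else 0))) := by
    -- For `R` slightly above 1 the circle separates the expanding roots from the others, so the
    -- integral is eventually constant and the limit is its value.
    have h1 : ∀ᶠ R : ℝ in 𝓝[>] 1, ∀ α ∈ complexRoots P, ‖α‖ ≠ R ∧ (‖α‖ < R ↔ ‖α‖ ≤ 1) := by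
      rw [Finset.eventually_all]
      intro α _
      rcases le_or_gt ‖α‖ 1 with h | h
      · filter_upwards [self_mem_nhdsWithin] with R hR
        have : ‖α‖ < R := lt_of_le_of_lt h hR
        exact ⟨this.ne, iff_of_true this h⟩
      · filter_upwards [Ioo_mem_nhdsGT h] with R hR
        exact ⟨hR.2.ne', iff_of_false hR.2.not_gt h.not_ge⟩
    filter_upwards [h1, self_mem_nhdsWithin] with R hR hR1
    have hR0 : 0 < R := lt_trans one_pos hR1
    have hz0 : ∀ z ∈ Metric.sphere (0 : ℂ) R, z ≠ 0 := by
      rintro z hz rfl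
      simp at hz
      exact hR0.ne hz
    have hzα : ∀ z ∈ Metric.sphere (0 : ℂ) R, z ∉ complexRoots P := fun z hz h =>
      (hR z h).1 (by simpa using hz)
    have h2 : Set.EqOn (fun z : ℂ => z ^ (n - 1) / aeval z P)
        (fun z => ∑ α ∈ complexRoots P, resInv P α * (z ^ (n - 1) * (z - α)⁻¹))
        (Metric.sphere 0 R) := fun z hz => by
      simp only [div_eq_mul_inv, hP.inv_aeval hm (hzα z hz), Finset.mul_sum]
      exact Finset.sum_congr rfl fun _ _ => by ring
    rw [circleIntegral.integral_congr hR0.le h2, circleIntegral.integral_fun_sum]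
    · rw [Finset.mul_sum]
      refine Finset.sum_congr rfl fun α hα => ?_
      rw [circleIntegral.integral_const_mul,
        circleIntegral_zpow_mul_inv (hP.ne_zero_of_mem hα) hR0 (hR α hα).1]
      simp only [(hR α hα).2]
      ring
    · intro α hα
      refine ContinuousOn.circleIntegrable hR0.le (continuousOn_const.mul
        ((continuousOn_id.zpow₀ _ fun z hz => Or.inl (hz0 z hz)).mul
        ((continuousOn_id.sub continuousOn_const).inv₀ fun z hz h => ?_)))
      obtain rfl : z = α := sub_eq_zero.1 h
      exact hzα z hz hα
  have hlim : limUnder (𝓝[>] (1 : ℝ)) (fun R : ℝ => ∮ z in C(0, R), z ^ (n - 1) / aeval z P) = _ :=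
    (tendsto_const_nhds.congr' (hev.mono fun _ h => h.symm)).limUnder_eq
  have hpi : (2 * Real.pi * Complex.I : ℂ) ≠ 0 := Complex.two_pi_I_ne_zero
  rw [rho, hlim, ← mul_assoc, div_mul_cancel₀ _ hpi, neg_one_mul, ← sum_expandingRoots_add]
  have e1 : ∑ α ∈ expandingRoots P, resInv P α * (α ^ (n - 1) *
      ((if ‖α‖ ≤ 1 then 1 else 0) - if n - 1 < 0 then 1 else 0)) =
      -(if n - 1 < 0 then 1 else 0) * ∑ α ∈ expandingRoots P, resInv P α * α ^ (n - 1) := by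
    rw [Finset.mul_sum]
    refine Finset.sum_congr rfl fun α hα => ?_
    rw [if_neg (mem_expandingRoots.1 hα).2.not_ge]
    ring
  have e2 : ∑ α ∈ nonexpandingRoots P, resInv P α * (α ^ (n - 1) *
      ((if ‖α‖ ≤ 1 then 1 else 0) - if n - 1 < 0 then 1 else 0)) =
      (1 - if n - 1 < 0 then 1 else 0) *
        ∑ α ∈ nonexpandingRoots P, resInv P α * α ^ (n - 1) := by
    rw [Finset.mul_sum]
    refine Finset.sum_congr rfl fun α hα => ?_
    rw [if_pos (mem_nonexpandingRoots.1 hα).2]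
    ring
  rw [e1, e2]
  by_cases h : 0 < n
  · obtain ⟨k, hk⟩ := Int.eq_ofNat_of_zero_le (show 0 ≤ n - 1 by omega)
    have h3 := hP.sum_resInv_mul_pow hm k
    rw [← sum_expandingRoots_add] at h3
    rw [if_neg (by omega), if_pos h, hk]
    simp only [zpow_natCast, Int.toNat_natCast]
    rw [← h3]
    ring
  · rw [if_pos (by omega), if_neg h]
    ring

/-- Only expanding roots enter on this side, only non-expanding ones in `rho_succ`; hence the
geometric decay in both directions in the hyperbolic case. -/
lemma Admissible.rho_neg (hP : Admissible P) (hm : P.Monic) (n : ℕ) :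
    rho P (-n) = ∑ α ∈ expandingRoots P, resInv P α * α⁻¹ * (α⁻¹) ^ n := by
  rw [hP.rho_eq hm, if_neg (by omega), sub_zero]
  refine Finset.sum_congr rfl fun α hα => ?_
  rw [zpow_sub_one₀ (hP.ne_zero_of_mem (mem_expandingRoots.1 hα).1), zpow_neg, zpow_natCast,
    inv_pow]
  ring

lemma Admissible.rho_succ (hP : Admissible P) (hm : P.Monic) (n : ℕ) :
    rho P (n + 1 : ℕ) = -∑ α ∈ nonexpandingRoots P, resInv P α * α ^ n := by
  rw [hP.rho_eq hm, if_pos (by omega)]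
  have e : ((n + 1 : ℕ) : ℤ) - 1 = n := by push_cast; ring
  rw [e, Int.toNat_natCast, ← hP.sum_resInv_mul_pow hm, ← sum_expandingRoots_add]
  simp only [zpow_natCast]
  ring

lemma Hyperbolic.norm_lt_one (hh : Hyperbolic P) {α : ℂ} (h : α ∈ nonexpandingRoots P) :
    ‖α‖ < 1 :=
  lt_of_le_of_ne (mem_nonexpandingRoots.1 h).2 (hh α (mem_nonexpandingRoots.1 h).1)

lemma summable_inv_pow {α : ℂ} (h : 1 < ‖α‖) : Summable fun j : ℕ => (α⁻¹) ^ j := by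
  have : ‖α⁻¹‖ < 1 := by
    rw [norm_inv]
    exact inv_lt_one_of_one_lt₀ h
  exact summable_geometric_of_norm_lt_one this

lemma Admissible.summable_norm_rho (hP : Admissible P) (hm : P.Monic) (hh : Hyperbolic P) :
    Summable fun n => ‖rho P n‖ := by
  refine Summable.of_nat_of_neg ?_ ?_
  · rw [← summable_nat_add_iff 1]
    simp_rw [hP.rho_succ hm]
    refine Summable.norm (Summable.neg (summable_sum fun α hα => ?_))
    exact (summable_geometric_of_norm_lt_one (hh.norm_lt_one hα)).mul_left _
  · simp_rw [hP.rho_neg hm]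
    refine Summable.norm (summable_sum fun α hα => ?_)
    exact (summable_inv_pow (mem_expandingRoots.1 hα).2).mul_left (resInv P α * α⁻¹)

/-! ### Elements of the spectrum from integer sequences. -/

lemma mem_spectrum_zero {c : ℂ → ℂ} (hc : ∀ α, c (starRingEnd ℂ α) = starRingEnd ℂ (c α)) :
    limsup (fun n : ℕ => distInt (∑ α ∈ expandingRoots P, c α * α ^ n).re) atTop ∈
      spectrum 0 P := by
  refine ⟨fun α => C (c α), fun α _ => ⟨(natDegree_C _).le, ?_⟩, ?_⟩
  · simp [hc]
  · simp [recSeq]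

/-- Every bounded sequence of integers gives rise to an element of the spectrum. -/
theorem Admissible.limsup_mem_spectrum (hP : Admissible P) (hm : P.Monic) {t : ℕ → ℤ} {B : ℝ}
    (ht : ∀ j, |(t j : ℝ)| ≤ B) :
    limsup (fun n : ℕ => distInt (∑' j : ℕ, (rho P (n - j)).re * t j)) atTop ∈ spectrum 0 P := by
  let c : ℂ → ℂ := fun α => resInv P α * ∑' j : ℕ, (t j : ℂ) * α ^ (-(j : ℤ) - 1)
  have hc : ∀ α, c (starRingEnd ℂ α) = starRingEnd ℂ (c α) := by
    intro α
    simp only [c, resInv_conj, map_mul, Complex.conj_tsum, map_zpow₀, map_intCast]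
  -- Interchanging the sums over `j` and `α` produces the coefficients `c α`. The impulse terms of
  -- `ρ_(n-j)` occur for `j < n` only and add up to an integer.
  have key : ∀ n : ℕ, ∑' j : ℕ, (rho P (n - j)).re * t j =
      (∑ α ∈ expandingRoots P, c α * α ^ n).re +
        ((-∑ j ∈ Finset.range n, impulse P (n - j - 1) * t j : ℤ) : ℝ) := by
    intro n
    have h1 : HasSum (fun j : ℕ => ∑ α ∈ expandingRoots P,
        resInv P α * α ^ ((n : ℤ) - j - 1) * t j) (∑ α ∈ expandingRoots P, c α * α ^ n) := by
      refine hasSum_sum fun α hα => ?_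
      have hα0 := hP.ne_zero_of_mem (mem_expandingRoots.1 hα).1
      have hsum : Summable fun j : ℕ => (t j : ℂ) * α ^ (-(j : ℤ) - 1) := by
        have hg := (summable_inv_pow (mem_expandingRoots.1 hα).2).norm
        refine Summable.of_norm_bounded ((hg.mul_right ‖α⁻¹‖).mul_left B) fun j => ?_
        rw [zpow_sub_one₀ hα0, zpow_neg, zpow_natCast, ← inv_pow, norm_mul, norm_mul,
          Complex.norm_intCast]
        gcongr
        exact ht j
      have h2 := (hsum.hasSum.mul_left (resInv P α)).mul_right (α ^ n)
      refine h2.congr_fun fun j => ?_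
      rw [sub_sub, add_comm, zpow_sub₀ hα0, zpow_natCast, sub_eq_add_neg, ← neg_add,
        zpow_neg, add_comm]
      ring
    have h2 : HasSum (fun j : ℕ => if j < n then (impulse P (n - j - 1) : ℂ) * t j else 0)
        (∑ j ∈ Finset.range n, (impulse P (n - j - 1) : ℂ) * t j) := by
      have : HasSum (fun j : ℕ => if j < n then (impulse P (n - j - 1) : ℂ) * t j else 0)
        (∑ j ∈ Finset.range n, if j < n then (impulse P (n - j - 1) : ℂ) * t j else 0) :=
        hasSum_sum_of_ne_finset_zero fun j hj => if_neg (by simpa using hj)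
      rwa [Finset.sum_congr rfl fun j hj => if_pos (by simpa using hj)] at this
    have h3 : HasSum (fun j : ℕ => rho P (n - j) * (t j : ℂ))
        (∑ α ∈ expandingRoots P, c α * α ^ n -
          ∑ j ∈ Finset.range n, (impulse P (n - j - 1) : ℂ) * t j) := by
      refine (h1.sub h2).congr_fun fun j => ?_
      rw [hP.rho_eq hm, sub_mul, Finset.sum_mul]
      congr 1
      have e : ((n : ℤ) - j - 1).toNat = n - j - 1 := by omega
      by_cases h : j < n
      · rw [if_pos (by omega), if_pos h, e]
      · rw [if_neg (by omega), if_neg h, zero_mul]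
    have h4 := (Complex.hasSum_re h3).tsum_eq
    have e : ∀ j : ℕ, (rho P (n - j) * (t j : ℂ)).re = (rho P (n - j)).re * t j := fun j => by
      simp
    simp_rw [e] at h4
    rw [h4, Complex.sub_re, sub_eq_add_neg]
    congr 1
    push_cast
    rw [← Complex.ofReal_re (∑ j ∈ Finset.range n, (impulse P (n - j - 1) : ℝ) * t j)]
    push_cast
    rfl
  simp_rw [key, distInt_add_intCast]
  exact mem_spectrum_zero hc

/-! ### Digit kernels and intervals from a dominant root. -/

lemma tendsto_sum_mul_pow {S : Finset ℂ} {k z : ℂ → ℂ} {α₀ u : ℂ} (h₀ : α₀ ∈ S)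
    (hu : z α₀ * u = 1) (h : ∀ α ∈ S, α ≠ α₀ → ‖z α * u‖ < 1) :
    Tendsto (fun j : ℕ => (∑ α ∈ S, k α * z α ^ j) * u ^ j) atTop (𝓝 (k α₀)) := by
  have h1 : ∀ α ∈ S, Tendsto (fun j : ℕ => k α * (z α * u) ^ j) atTop
      (𝓝 (if α = α₀ then k α else 0)) := by
    intro α hα
    split_ifs with hαα
    · subst hαα
      simp [hu]
    · simpa using (tendsto_pow_atTop_nhds_zero_of_norm_lt_one (h α hα hαα)).const_mul (k α)
  have h2 := tendsto_finsetSum S h1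
  rw [Finset.sum_ite_eq_of_mem' S α₀ _ h₀] at h2
  refine h2.congr fun j => ?_
  rw [Finset.sum_mul]
  exact Finset.sum_congr rfl fun α _ => by rw [mul_pow]; ring

/-- The conjugate has the same modulus, so uniqueness makes the root real. -/
lemma exists_ofReal_eq {S : Finset ℂ} (hS : ∀ α ∈ S, starRingEnd ℂ α ∈ S) {α₀ : ℂ} (h₀ : α₀ ∈ S)
    (h : ∀ α ∈ S, ‖α‖ = ‖α₀‖ → α = α₀) : ∃ a : ℝ, (a : ℂ) = α₀ :=
  ⟨α₀.re, Complex.conj_eq_iff_re.1 (h _ (hS _ h₀) (by simp))⟩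

lemma conj_mem_expandingRoots (hP : P ≠ 0) {α : ℂ} (h : α ∈ expandingRoots P) :
    starRingEnd ℂ α ∈ expandingRoots P := by
  rw [mem_expandingRoots] at h ⊢
  exact ⟨conj_mem_complexRoots hP h.1, by simpa using h.2⟩

lemma conj_mem_nonexpandingRoots (hP : P ≠ 0) {α : ℂ} (h : α ∈ nonexpandingRoots P) :
    starRingEnd ℂ α ∈ nonexpandingRoots P := by
  rw [mem_nonexpandingRoots] at h ⊢
  exact ⟨conj_mem_complexRoots hP h.1, by simpa using h.2⟩

lemma Admissible.re_resInv_mul_inv_ne_zero (hP : Admissible P) (hm : P.Monic) {a : ℝ}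
    (h : (a : ℂ) ∈ complexRoots P) : (resInv P a * (a : ℂ)⁻¹).re ≠ 0 := by
  intro h0
  have h1 : starRingEnd ℂ (resInv P a * (a : ℂ)⁻¹) = resInv P a * (a : ℂ)⁻¹ := by
    rw [map_mul, map_inv₀, ← resInv_conj, Complex.conj_ofReal]
  rw [Complex.conj_eq_iff_re, h0, Complex.ofReal_zero, eq_comm] at h1
  exact mul_ne_zero (hP.resInv_ne_zero hm h) (inv_ne_zero (hP.ne_zero_of_mem h)) h1

lemma Admissible.summable_re_rho (hP : Admissible P) (hm : P.Monic) (hh : Hyperbolic P) :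
    Summable fun n => |(rho P n).re| :=
  Summable.of_nonneg_of_le (fun _ => abs_nonneg _) (fun n => Complex.abs_re_le_norm (rho P n))
    (hP.summable_norm_rho hm hh)

lemma Admissible.mul_tsum_re_rho_lt (hP : Admissible P) (hm : P.Monic) (hh : Hyperbolic P) {M : ℤ}
    (hM : 0 ≤ M) {v : ℝ} (h : M * ∑' n, ‖rho P n‖ < v) : M * ∑' n, |(rho P n).re| < v := by
  refine lt_of_le_of_lt ?_ h
  have : (0 : ℝ) ≤ M := by exact_mod_cast hM
  exact mul_le_mul_of_nonneg_left ((hP.summable_re_rho hm hh).tsum_le_tsum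
    (fun n => Complex.abs_re_le_norm (rho P n)) (hP.summable_norm_rho hm hh)) this

/-- An expanding root is not an extremal integer. -/
lemma Admissible.expanding_lt_digits (hP : Admissible P) (hm : P.Monic) (hh : Hyperbolic P) {M : ℤ}
    {a : ℝ} (h₀ : (a : ℂ) ∈ expandingRoots P) (hM : |a| ≤ 2 * M + 1)
    (hlt : M * ∑' n, ‖rho P n‖ < 1 / 2) : |a| < 2 * M + 1 := by
  -- Equality would make `a` an integer root, hence `P = X - a`; then `∑ |ρ_(-n)|` over `n ≥ 0` is
  -- `1 / (|a| - 1) = 1 / (2M)`, contradicting `hlt`.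
  refine lt_of_le_of_ne hM fun heq => ?_
  obtain ⟨h1, h2⟩ := mem_expandingRoots.1 h₀
  rw [Complex.norm_real, Real.norm_eq_abs] at h2
  have hMpos : (0 : ℝ) < M := by linarith
  obtain ⟨b, hb⟩ : ∃ b : ℤ, (b : ℝ) = a := by
    rcases abs_choice a with h | h
    · exact ⟨2 * M + 1, by push_cast; linarith⟩
    · exact ⟨-(2 * M + 1), by push_cast; linarith⟩
  have hroot : P.IsRoot b := by
    rw [mem_complexRoots hm.ne_zero, ← hb] at h1
    have h3 : aeval (algebraMap ℤ ℂ b) P = 0 := by simpa using h1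
    rw [aeval_algebraMap_apply_eq_algebraMap_eval] at h3
    simpa using h3
  have hPb : X - C b = P := by
    rcases hP.irreducible.dvd_iff.1 (dvd_iff_isRoot.2 hroot) with h | h
    · exact absurd h (not_isUnit_X_sub_C b)
    · exact eq_of_monic_of_associated (monic_X_sub_C b) hm h.symm
  have hexp : expandingRoots P = {(a : ℂ)} := by
    rw [Finset.eq_singleton_iff_unique_mem]
    refine ⟨h₀, fun α hα => ?_⟩
    have h3 := (mem_complexRoots hm.ne_zero).1 (mem_expandingRoots.1 hα).1
    rw [← hPb] at h3
    simp only [map_sub, aeval_X, aeval_C, sub_eq_zero] at h3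
    rw [h3, ← hb]
    simp
  have hres : resInv P a = 1 := by
    rw [resInv, ← hPb]
    simp
  have hnorm : ∀ n : ℕ, ‖rho P (-n)‖ = |a|⁻¹ * |a|⁻¹ ^ n := fun n => by
    rw [hP.rho_neg hm, hexp]
    simp [hres]
  have hgeom : HasSum (fun n : ℕ => ‖rho P (-n)‖) (|a|⁻¹ * (1 - |a|⁻¹)⁻¹) := by
    simp_rw [hnorm]
    exact (hasSum_geometric_of_lt_one (by positivity) (inv_lt_one_of_one_lt₀ h2)).mul_left _
  have hle : |a|⁻¹ * (1 - |a|⁻¹)⁻¹ ≤ ∑' n, ‖rho P n‖ := by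
    rw [← hgeom.tsum_eq]
    exact tsum_comp_le_tsum_of_inj (hP.summable_norm_rho hm hh) (fun _ => norm_nonneg _)
      (i := fun n : ℕ => -(n : ℤ)) fun i j h => by simpa using h
  have heq' : |a|⁻¹ * (1 - |a|⁻¹)⁻¹ = (2 * (M : ℝ))⁻¹ := by
    rw [heq, ← mul_inv]
    congr 1
    field_simp
    ring
  rw [heq'] at hle
  have := mul_le_mul_of_nonneg_left hle hMpos.le
  have e : (M : ℝ) * (2 * (M : ℝ))⁻¹ = 1 / 2 := by field_simp
  linarith

theorem Admissible.exists_digitKernel_expanding (hP : Admissible P) (hm : P.Monic)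
    (hh : Hyperbolic P) {M : ℤ} {α₀ : ℂ} (h₀ : α₀ ∈ expandingRoots P)
    (hmin : ∀ α ∈ expandingRoots P, α ≠ α₀ → ‖α₀‖ < ‖α‖) (hM : ‖α₀‖ ≤ 2 * M + 1)
    (hlt : M * ∑' n, ‖rho P n‖ < 1 / 2) :
    ∃ a C, DigitKernel (fun n => (rho P n).re) M a C := by
  obtain ⟨a, rfl⟩ := exists_ofReal_eq (fun α => conj_mem_expandingRoots hm.ne_zero) h₀
    fun α hα h => by_contra fun hne => (hmin α hα hne).ne' h
  obtain ⟨h1, h2⟩ := mem_expandingRoots.1 h₀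
  have ha0 := hP.ne_zero_of_mem h1
  rw [Complex.norm_real, Real.norm_eq_abs] at h2 hM
  have hlt' := hP.expanding_lt_digits hm hh h₀ hM hlt
  have hM0 : (0 : ℝ) < M := by linarith
  refine ⟨a, (resInv P a * (a : ℂ)⁻¹).re, hP.summable_re_rho hm hh, h2, hlt',
    hP.re_resInv_mul_inv_ne_zero hm h1, ?_,
    hP.mul_tsum_re_rho_lt hm hh (by exact_mod_cast hM0.le) hlt⟩
  have h3 := tendsto_sum_mul_pow (k := fun α => resInv P α * α⁻¹) (z := fun α => α⁻¹) (u := (a : ℂ))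
    h₀ (inv_mul_cancel₀ ha0) fun α hα hne => by
      have h4 := hmin α hα hne
      have h5 : 0 < ‖α‖ := lt_of_le_of_lt (norm_nonneg _) h4
      rwa [norm_mul, norm_inv, inv_mul_lt_one₀ h5]
  refine ((Complex.continuous_re.tendsto _).comp h3).congr fun j => ?_
  simp only [Function.comp]
  rw [← hP.rho_neg hm, ← Complex.ofReal_pow, Complex.re_mul_ofReal]

/-- The inverse of a nonexpanding root is not an integer. -/
lemma Admissible.nonexpanding_lt_digits (hP : Admissible P) (hm : P.Monic) (hh : Hyperbolic P)
    {M : ℤ} {a : ℝ} (h₀ : (a : ℂ) ∈ nonexpandingRoots P) (hM : |a⁻¹| ≤ 2 * M + 1) :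
    |a⁻¹| < 2 * M + 1 := by
  refine lt_of_le_of_ne hM fun heq => ?_
  have h1 := (mem_nonexpandingRoots.1 h₀).1
  have h2 := hh.norm_lt_one h₀
  have ha0 : a ≠ 0 := fun h => hP.ne_zero_of_mem h1 (by simp [h])
  rw [Complex.norm_real, Real.norm_eq_abs] at h2
  obtain ⟨b, hb⟩ : ∃ b : ℤ, (b : ℝ) = a⁻¹ := by
    rcases abs_choice a⁻¹ with h | h
    · exact ⟨2 * M + 1, by push_cast; linarith⟩
    · exact ⟨-(2 * M + 1), by push_cast; linarith⟩
  -- A rational root of a monic integer polynomial is an integer; modulus below 1 would force `a =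
  -- 0`.
  have hab : a = ((b : ℚ)⁻¹ : ℚ) := by
    push_cast
    rw [hb, inv_inv]
  have hroot : aeval ((b : ℚ)⁻¹ : ℚ) P = 0 := by
    rw [mem_complexRoots hm.ne_zero, hab] at h1
    have h3 : aeval (algebraMap ℚ ℂ (b : ℚ)⁻¹) P = 0 := by simpa using h1
    rw [aeval_algebraMap_apply] at h3
    simpa using h3
  obtain ⟨c, hc⟩ := isInteger_of_is_root_of_monic hm hroot
  have hca : (c : ℝ) = a := by
    rw [hab, ← hc]
    simp
  rw [← hca] at h2 ha0
  have h3 : |c| < 1 := by exact_mod_cast h2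
  rw [Int.abs_lt_one_iff] at h3
  simp [h3] at ha0

/-- Reversing time exchanges the two sides of `ρ`; the dominant ratio becomes the inverse of the
non-expanding root. -/
theorem Admissible.exists_digitKernel_nonexpanding (hP : Admissible P) (hm : P.Monic)
    (hh : Hyperbolic P) {M : ℤ} {α₀ : ℂ} (h₀ : α₀ ∈ nonexpandingRoots P)
    (hmin : ∀ α ∈ nonexpandingRoots P, α ≠ α₀ → ‖α₀‖⁻¹ < ‖α‖⁻¹) (hM : ‖α₀‖⁻¹ ≤ 2 * M + 1)
    (hlt : M * ∑' n, ‖rho P n‖ < 1 / 2) :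
    ∃ a C, DigitKernel (fun n => (rho P (-n)).re) M a C := by
  obtain ⟨a, rfl⟩ := exists_ofReal_eq (fun α => conj_mem_nonexpandingRoots hm.ne_zero) h₀
    fun α hα h => by_contra fun hne => (hmin α hα hne).ne (by rw [h])
  have h1 := (mem_nonexpandingRoots.1 h₀).1
  have h2 := hh.norm_lt_one h₀
  have ha0 := hP.ne_zero_of_mem h1
  have ha0' : 0 < |a| := abs_pos.2 fun h => ha0 (by simp [h])
  rw [Complex.norm_real, Real.norm_eq_abs] at h2
  rw [Complex.norm_real, Real.norm_eq_abs, ← abs_inv] at hM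
  have hlt' := hP.nonexpanding_lt_digits hm hh h₀ hM
  have h2' : 1 < |a⁻¹| := by rw [abs_inv]; exact (one_lt_inv₀ ha0').2 h2
  have hM0 : (0 : ℝ) < M := by linarith
  refine ⟨a⁻¹, -(resInv P a * (a : ℂ)⁻¹).re,
    (Equiv.neg ℤ).summable_iff.2 (hP.summable_re_rho hm hh), h2', hlt',
    neg_ne_zero.2 (hP.re_resInv_mul_inv_ne_zero hm h1), ?_, ?_⟩
  · have h3 := tendsto_sum_mul_pow (k := fun α => resInv P α) (z := fun α => α)
      (u := (a : ℂ)⁻¹) h₀ (mul_inv_cancel₀ ha0) fun α hα hne => by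
        have h4 := hmin α hα hne
        have h5 : 0 < ‖α‖ := norm_pos_iff.2 (hP.ne_zero_of_mem (mem_nonexpandingRoots.1 hα).1)
        have h6 : 0 < ‖(a : ℂ)‖ := norm_pos_iff.2 ha0
        rw [norm_mul, norm_inv, mul_inv_lt_iff₀ h6, one_mul]
        exact (inv_lt_inv₀ h6 h5).1 h4
    -- The index shift matches `ρ_(n+1)` with `α ^ n` and puts the extra factor `a⁻¹` into the
    -- limit.
    rw [← tendsto_add_atTop_iff_nat 1]
    have h7 := ((Complex.continuous_re.tendsto _).comp (h3.mul_const (a : ℂ)⁻¹)).neg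
    refine h7.congr fun j => ?_
    simp only [Function.comp, neg_neg]
    rw [hP.rho_succ hm, mul_assoc, ← pow_succ, ← Complex.ofReal_inv, ← Complex.ofReal_pow,
      Complex.re_mul_ofReal, Complex.neg_re, neg_mul]
  · have := (Equiv.neg ℤ).tsum_eq fun n => |(rho P n).re|
    simp only [Equiv.neg_apply] at this
    rw [this]
    exact hP.mul_tsum_re_rho_lt hm hh (by exact_mod_cast hM0.le) hlt

lemma Admissible.mem_spectrum_of_convInt (hP : Admissible P) (hm : P.Monic) (hh : Hyperbolic P)
    {M : ℤ} (hM : 0 ≤ M) {s : ℤ → ℤ} {m : ℤ} (hs : ∀ j, j ≠ m → |s j| ≤ M) {y : ℝ}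
    (hy : M * ∑' j, |(rho P j).re| ≤ y) {n₀ : ℤ}
    (hn₀ : distInt (convInt (fun n => (rho P n).re) s n₀) = y)
    (hle : ∀ n, distInt (convInt (fun n => (rho P n).re) s n) ≤ y) : y ∈ spectrum 0 P := by
  obtain ⟨t, B, ht, rfl⟩ := exists_limsup_distInt_eq (hP.summable_re_rho hm hh) hM hs hy hn₀ hle
  exact hP.limsup_mem_spectrum hm ht

theorem Admissible.Icc_subset_of_expanding (hP : Admissible P) (hm : P.Monic)
    (hh : Hyperbolic P) {M : ℤ} {α₀ : ℂ} (h₀ : α₀ ∈ expandingRoots P)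
    (hmin : ∀ α ∈ expandingRoots P, α ≠ α₀ → ‖α₀‖ < ‖α‖) (hM : ‖α₀‖ ≤ 2 * M + 1)
    (hlt : M * ∑' n, ‖rho P n‖ < 1 / 2) :
    ∃ v : ℝ, v < 1 / 2 ∧ Set.Icc v (1 / 2) ⊆ spectrum 0 P := by
  obtain ⟨a, C, h⟩ := hP.exists_digitKernel_expanding hm hh h₀ hmin hM hlt
  obtain ⟨v, hv, hMv, hint⟩ := h.exists_interval
  refine ⟨v, hv, fun y hy => ?_⟩
  obtain ⟨s, ⟨m, hs⟩, n₀, h1, h2⟩ := hint y hy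
  exact hP.mem_spectrum_of_convInt hm hh h.digits_nonneg hs (hMv.trans hy.1) h1 h2

theorem Admissible.Icc_subset_of_nonexpanding (hP : Admissible P) (hm : P.Monic)
    (hh : Hyperbolic P) {M : ℤ} {α₀ : ℂ} (h₀ : α₀ ∈ nonexpandingRoots P)
    (hmin : ∀ α ∈ nonexpandingRoots P, α ≠ α₀ → ‖α₀‖⁻¹ < ‖α‖⁻¹) (hM : ‖α₀‖⁻¹ ≤ 2 * M + 1)
    (hlt : M * ∑' n, ‖rho P n‖ < 1 / 2) :
    ∃ v : ℝ, v < 1 / 2 ∧ Set.Icc v (1 / 2) ⊆ spectrum 0 P := by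
  obtain ⟨a, C, h⟩ := hP.exists_digitKernel_nonexpanding hm hh h₀ hmin hM hlt
  obtain ⟨v, hv, hMv, hint⟩ := h.exists_interval
  have e := (Equiv.neg ℤ).tsum_eq fun n => |(rho P n).re|
  simp only [Equiv.neg_apply] at e
  rw [e] at hMv
  refine ⟨v, hv, fun y hy => ?_⟩
  obtain ⟨s, ⟨m, hs⟩, n₀, h1, h2⟩ := hint y hy
  refine hP.mem_spectrum_of_convInt hm hh h.digits_nonneg (s := fun j => s (-j)) (m := -m)
    (fun j hj => hs _ fun h => hj (by omega)) (hMv.trans hy.1) (n₀ := -n₀) ?_ fun n => ?_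
  · rw [convInt_reflect, neg_neg, h1]
  · rw [convInt_reflect]
    exact h2 _

/-! ### Accumulation at `1/2` through odd primes. -/

/-- As `q` does not divide `P(0)`, `X` is a unit of finite order in the finite ring `𝔽_q[X] / (P)`.
So the impulse response is purely periodic modulo `q`, and its value 1 at `deg P - 1` recurs. -/
lemma Admissible.frequently_impulse_eq_one (hP : Admissible P) (hm : P.Monic) {q : ℕ}
    (hq : q.Prime) (h0 : ¬ (q : ℤ) ∣ P.coeff 0) :
    ∃ᶠ n in atTop, (impulse P n : ZMod q) = 1 := by
  have := Fact.mk hq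
  set Q : (ZMod q)[X] := P.map (Int.castRingHom (ZMod q)) with hQ
  have hQm : Q.Monic := hm.map _
  have hdeg : Q.natDegree = P.natDegree := hm.natDegree_map _
  have := hQm.finite_adjoinRoot
  have : Finite (AdjoinRoot Q) := Module.finite_of_finite (ZMod q)
  have hunit : IsUnit (AdjoinRoot.root Q) := by
    have h1 := congrArg (AdjoinRoot.mk Q) (divX_mul_X_add Q)
    rw [AdjoinRoot.mk_self, map_add, map_mul, AdjoinRoot.mk_X, AdjoinRoot.mk_C,
      add_eq_zero_iff_eq_neg] at h1
    have h2 : IsUnit (Q.coeff 0) := by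
      rw [isUnit_iff_ne_zero, hQ, coeff_map, eq_intCast, Ne, ZMod.intCast_zmod_eq_zero_iff_dvd]
      exact h0
    have h3 : IsUnit (AdjoinRoot.mk Q Q.divX * AdjoinRoot.root Q) := by
      rw [h1]
      exact (h2.map (AdjoinRoot.of Q)).neg
    exact isUnit_of_mul_isUnit_right h3
  obtain ⟨u, hu⟩ := hunit
  rw [frequently_atTop]
  intro N
  refine ⟨N * orderOf u + (P.natDegree - 1), ?_, ?_⟩
  · have := orderOf_pos u
    nlinarith
  · have h1 : AdjoinRoot.mk Q (X ^ (N * orderOf u + (P.natDegree - 1))) =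
        AdjoinRoot.mk Q (X ^ (P.natDegree - 1)) := by
      rw [map_pow, map_pow, AdjoinRoot.mk_X, ← hu, pow_add, mul_comm N, pow_mul]
      rw [← Units.val_pow_eq_pow_val, pow_orderOf_eq_one]
      simp
    rw [AdjoinRoot.mk_eq_mk] at h1
    have h2 := modByMonic_eq_of_dvd_sub hQm h1
    have h3 : (X ^ (P.natDegree - 1) : (ZMod q)[X]) %ₘ Q = X ^ (P.natDegree - 1) := by
      rw [modByMonic_eq_self_iff hQm, degree_X_pow, degree_eq_natDegree hQm.ne_zero, hdeg]
      have := hP.one_le_natDegree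
      exact_mod_cast (by omega : P.natDegree - 1 < P.natDegree)
    have h4 := congrArg (fun p => coeff p (P.natDegree - 1))
      (map_modByMonic (Int.castRingHom (ZMod q)) hm
        (p := X ^ (N * orderOf u + (P.natDegree - 1))))
    simp only [coeff_map, Polynomial.map_pow, map_X, ← hQ, h2, h3, coeff_X_pow_self] at h4
    simpa [impulse] using h4

/-- Homogeneous sequences modulo an odd prime produce values close to `1 / 2`. -/
theorem Admissible.half_sub_mem_spectrum (hP : Admissible P) (hm : P.Monic) (hh : Hyperbolic P)
    {q : ℕ} (hq : q.Prime) (hq2 : q ≠ 2) (h0 : ¬ (q : ℤ) ∣ P.coeff 0) :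
    1 / 2 - 1 / (2 * q : ℝ) ∈ spectrum 0 P := by
  obtain ⟨u, hu⟩ := hq.odd_of_ne_two hq2
  have hq0 : (0 : ℝ) < q := by exact_mod_cast hq.pos
  have huR : (q : ℝ) = 2 * u + 1 := by exact_mod_cast hu
  set κ : ℝ := u / q with hκ
  have hκ' : 1 / 2 - 1 / (2 * q : ℝ) = κ := by
    rw [hκ]
    field_simp
    linarith
  rw [hκ']
  have hc : ∀ α, (κ : ℂ) * resInv P (starRingEnd ℂ α) = starRingEnd ℂ (κ * resInv P α) :=
    fun α => by rw [resInv_conj, map_mul, Complex.conj_ofReal]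
  have hmem := mem_spectrum_zero (P := P) (c := fun α => κ * resInv P α) hc
  -- The sum over all roots is the integer `impulse P n`; the expanding part differs from it by
  -- terms tending to 0.
  set err : ℕ → ℝ := fun n => (κ * ∑ α ∈ nonexpandingRoots P, resInv P α * α ^ n : ℂ).re with herr
  have hval : ∀ n : ℕ, (∑ α ∈ expandingRoots P, κ * resInv P α * α ^ n).re =
      κ * impulse P n - err n := by
    intro n
    have h1 := hP.sum_resInv_mul_pow hm n
    rw [← sum_expandingRoots_add, ← eq_sub_iff_add_eq] at h1
    simp_rw [mul_assoc, ← Finset.mul_sum, h1, herr, mul_sub, Complex.sub_re]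
    rw [← Complex.ofReal_intCast, ← Complex.ofReal_mul, Complex.ofReal_re]
  have herr0 : Tendsto err atTop (𝓝 0) := by
    have h1 : Tendsto (fun n : ℕ => (κ * ∑ α ∈ nonexpandingRoots P, resInv P α * α ^ n : ℂ)) atTop
        (𝓝 (κ * ∑ α ∈ nonexpandingRoots P, resInv P α * 0)) :=
      (tendsto_finsetSum _ fun α hα =>
        (tendsto_pow_atTop_nhds_zero_of_norm_lt_one (hh.norm_lt_one hα)).const_mul _).const_mul _
    simp only [mul_zero, Finset.sum_const_zero] at h1
    exact (Complex.continuous_re.tendsto _).comp h1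
  have hsmall : ∀ δ > 0, ∀ᶠ n in atTop, |err n| ≤ δ := fun δ hδ => by
    have h1 := herr0.abs
    rw [abs_zero] at h1
    exact (h1.eventually (gt_mem_nhds hδ)).mono fun _ h => h.le
  -- The distance is a multiple of `1 / q` not exceeding `1/2`; as `q = 2u + 1` is odd, it is at
  -- most `u / q = κ`.
  have hle : ∀ k : ℤ, distInt (κ * k) ≤ κ := by
    intro k
    have h1 := distInt_le_half (κ * k)
    have h2 : distInt (κ * k) = ((|u * k - q * round (κ * k)| : ℤ) : ℝ) / q := by
      rw [distInt, hκ]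
      push_cast
      rw [← abs_of_pos hq0, ← abs_div, abs_of_pos hq0]
      congr 1
      field_simp
    rw [h2, div_le_iff₀ hq0] at h1
    rw [h2, hκ]
    gcongr
    rw [huR] at h1
    have h3 : (2 * |u * k - q * round (κ * k)| : ℤ) ≤ 2 * u + 1 := by
      have : (2 * (|u * k - q * round (κ * k)| : ℤ) : ℝ) ≤ 2 * u + 1 := by linarith
      exact_mod_cast this
    have h4 : |u * k - q * round (κ * k)| ≤ u := by omega
    exact_mod_cast h4
  have heq : ∀ k : ℤ, (k : ZMod q) = 1 → distInt (κ * k) = κ := by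
    intro k hk
    have h1 : (q : ℤ) ∣ k - 1 := by
      rw [← ZMod.intCast_zmod_eq_zero_iff_dvd]
      simp [hk]
    obtain ⟨l, hl⟩ := h1
    have h2 : (k : ℝ) = 1 + q * l := by
      have : k = 1 + q * l := by linarith
      rw [this]
      push_cast
      ring
    have h3 : κ * k = κ + ((u * l : ℤ) : ℝ) := by
      rw [h2, hκ]
      push_cast
      field_simp
    have hκ0 : 0 ≤ κ := by positivity
    rw [h3, distInt_add_intCast, distInt_eq_abs, abs_of_nonneg hκ0]
    rw [abs_of_nonneg hκ0, ← hκ']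
    have : 0 < 1 / (2 * q : ℝ) := by positivity
    linarith
  have hdiff : ∀ n, |distInt (κ * impulse P n - err n) - distInt (κ * impulse P n)| ≤ |err n| :=
    fun n => (abs_distInt_sub_le _ _).trans (by simp)
  simp_rw [hval] at hmem
  rwa [limsup_distInt_eq (y := κ)] at hmem
  · intro δ hδ
    filter_upwards [hsmall δ hδ] with n hn
    have := (abs_le.1 (hdiff n)).2
    linarith [hle (impulse P n)]
  · intro δ hδ
    refine ((hP.frequently_impulse_eq_one hm hq h0).and_eventually (hsmall δ hδ)).mono ?_
    rintro n ⟨h1, h2⟩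
    have := (abs_le.1 (hdiff n)).1
    linarith [heq _ h1]

lemma spectrum_zero_subset (k : ℕ) (P : ℤ[X]) : spectrum 0 P ⊆ spectrum k P := by
  rintro y ⟨g, hg, rfl⟩
  exact ⟨g, fun α hα => ⟨(hg α hα).1.trans k.zero_le, (hg α hα).2⟩, rfl⟩

theorem Admissible.accPt_spectrum (hP : Admissible P) (hm : P.Monic) (hh : Hyperbolic P) (k : ℕ) :
    AccPt (1 / 2 : ℝ) (𝓟 (spectrum k P)) := by
  rw [accPt_iff_nhds]
  intro U hU
  obtain ⟨ε, hε, hεU⟩ := Metric.mem_nhds_iff.1 hU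
  obtain ⟨N, hN⟩ := exists_nat_gt (1 / ε)
  obtain ⟨q, hqN, hq⟩ := Nat.exists_infinite_primes (N + (P.coeff 0).natAbs + 3)
  have hq0 : (0 : ℝ) < q := by exact_mod_cast hq.pos
  have h0 : ¬ (q : ℤ) ∣ P.coeff 0 := by
    intro h
    have := Int.le_of_dvd (abs_pos.2 hP.coeff_zero_ne) ((dvd_abs _ _).2 h)
    rw [Int.abs_eq_natAbs] at this
    omega
  have hpos : 0 < 1 / (2 * q : ℝ) := by positivity
  refine ⟨1 / 2 - 1 / (2 * q : ℝ), ⟨hεU ?_, spectrum_zero_subset k P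
    (hP.half_sub_mem_spectrum hm hh hq (by omega) h0)⟩, by linarith⟩
  rw [Metric.mem_ball, Real.dist_eq, sub_sub_cancel_left, abs_neg, abs_of_pos hpos,
    div_lt_iff₀ (by positivity)]
  have h1 : (N : ℝ) ≤ q := by exact_mod_cast (by omega : N ≤ q)
  have h2 : 1 < q * ε := by
    rw [div_lt_iff₀ hε] at hN
    nlinarith
  nlinarith

/-! ### Extremal moduli and the conclusion. -/

lemma beta_le_of_expanding {α : ℂ} (h : α ∈ expandingRoots P) : beta P ≤ ‖α‖ := by
  refine csInf_le ⟨0, ?_⟩ (Or.inl ⟨α, h, rfl⟩)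
  rintro r (⟨α, -, rfl⟩ | ⟨α, -, rfl⟩) <;> positivity

lemma beta_le_of_nonexpanding {α : ℂ} (h : α ∈ nonexpandingRoots P) : beta P ≤ ‖α‖⁻¹ := by
  refine csInf_le ⟨0, ?_⟩ (Or.inr ⟨α, h, rfl⟩)
  rintro r (⟨α, -, rfl⟩ | ⟨α, -, rfl⟩) <;> positivity

lemma beta₁_le {α : ℂ} (h : α ∈ expandingRoots P) : beta₁ P ≤ ‖α‖ := by
  refine csInf_le ⟨0, ?_⟩ ⟨α, h, rfl⟩
  rintro r ⟨α, -, rfl⟩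
  positivity

lemma le_two_mul_ceil (x : ℝ) : x ≤ 2 * (⌈(x - 1) / 2⌉ : ℝ) + 1 := by
  have := Int.le_ceil ((x - 1) / 2)
  linarith

end MarkoffLagrange

theorem theorem4p3 (P : Polynomial ℤ) (hP : MarkoffLagrange.Admissible P) (hmonic : P.Monic)
    (hhyp : MarkoffLagrange.Hyperbolic P) :
    (∀ k : ℕ, AccPt (1 / 2 : ℝ) (𝓟 (MarkoffLagrange.spectrum k P))) ∧
    (((∃! α : ℂ, α ∈ MarkoffLagrange.expandingRoots P ∧ ‖α‖ = MarkoffLagrange.beta P) ∨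
        (∃! α : ℂ, α ∈ MarkoffLagrange.nonexpandingRoots P ∧ ‖α‖⁻¹ = MarkoffLagrange.beta P)) →
      (⌈(MarkoffLagrange.beta P - 1) / 2⌉ : ℝ) * ∑' n : ℤ, ‖MarkoffLagrange.rho P n‖ < 1 / 2 →
      ∃ c d : ℕ → ℝ,
        (∀ i, c i < d i ∧ Set.Icc (c i) (d i) ⊆ MarkoffLagrange.spectrum 0 P) ∧
        Tendsto c atTop (𝓝 (1 / 2))) ∧
    ((∃! α : ℂ, α ∈ MarkoffLagrange.expandingRoots P ∧ ‖α‖ = MarkoffLagrange.beta₁ P) →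
      (∃! α : ℂ, α ∈ MarkoffLagrange.nonexpandingRoots P ∧ ‖α‖⁻¹ = MarkoffLagrange.beta₂ P) →
      (⌈(max (MarkoffLagrange.beta₁ P) (MarkoffLagrange.beta₂ P) - 1) / 2⌉ : ℝ) *
        ∑' n : ℤ, ‖MarkoffLagrange.rho P n‖ < 1 / 2 →
      ∃ v : ℝ, v < 1 / 2 ∧ Set.Icc v (1 / 2) ⊆ MarkoffLagrange.spectrum 0 P) := by
  refine ⟨hP.accPt_spectrum hmonic hhyp, fun hβ hlt => ?_, ?_⟩
  · have hv : ∃ v : ℝ, v < 1 / 2 ∧ Set.Icc v (1 / 2) ⊆ MarkoffLagrange.spectrum 0 P := by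
      rcases hβ with ⟨α₀, ⟨h₀, hα₀⟩, huniq⟩ | ⟨α₀, ⟨h₀, hα₀⟩, huniq⟩
      · refine hP.Icc_subset_of_expanding hmonic hhyp h₀ (fun α hα hne => ?_)
          (hα₀.trans_le (MarkoffLagrange.le_two_mul_ceil _)) hlt
        rw [hα₀]
        exact lt_of_le_of_ne (MarkoffLagrange.beta_le_of_expanding hα) fun h => hne (huniq α ⟨hα, h.symm⟩)
      · refine hP.Icc_subset_of_nonexpanding hmonic hhyp h₀ (fun α hα hne => ?_)
          (hα₀.trans_le (MarkoffLagrange.le_two_mul_ceil _)) hlt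
        rw [hα₀]
        exact lt_of_le_of_ne (MarkoffLagrange.beta_le_of_nonexpanding hα) fun h => hne (huniq α ⟨hα, h.symm⟩)
    obtain ⟨v, hv, hsub⟩ := hv
    -- Nested subintervals of `[v, 1/2]` that share the right endpoint `1/2`.
    refine ⟨fun i => max v (1 / 2 - 1 / ((i : ℝ) + 1)), fun _ => 1 / 2, fun i => ⟨?_, ?_⟩, ?_⟩
    · have : 0 < 1 / ((i : ℝ) + 1) := by positivity
      exact max_lt hv (by linarith)
    · exact (Set.Icc_subset_Icc_left (le_max_left _ _)).trans hsub
    · have := (tendsto_const_nhds (x := v)).max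
        ((tendsto_one_div_add_atTop_nhds_zero_nat (𝕜 := ℝ)).const_sub (1 / 2))
      rwa [sub_zero, max_eq_right hv.le] at this
  · rintro ⟨α₀, ⟨h₀, hα₀⟩, huniq⟩ - hlt
    refine hP.Icc_subset_of_expanding hmonic hhyp h₀ (fun α hα hne => ?_)
      (hα₀.trans_le ((le_max_left _ _).trans (MarkoffLagrange.le_two_mul_ceil _))) hlt
    rw [hα₀]
    exact lt_of_le_of_ne (MarkoffLagrange.beta₁_le hα) fun h => hne (huniq α ⟨hα, h.symm⟩)
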